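/- An input-driven pushdown automaton with translucent letters (NIDPDAwtl) is a system $M=\langle Q,\Sigma,\Gamma,q_0,\lhd,\bot,\tau,\delta_D,\delta_R,\delta_N\rangle$ with finite sets $Q$ (states), $\Sigma=\Sigma_D\,\dot\cup\,\Sigma_R\,\dot\cup\,\Sigma_N$ (input letters, partitioned into pushing, popping and neutral letters) and $\Gamma$ (pushdown symbols), initial state $q_0\in Q$, endmarker $\lhd\notin\Sigma$, bottom symbol $\bot\notin\Gamma$, translucency mapping $\tau:Q\to 2^\Sigma$, and partial transition functions $\delta_D:Q\times\Sigma_D\times(\Gamma\cup\{\bot\})\to 2^{Q\times\Gamma}\cup\{\mathtt{accept}\}$, $\delta_R:Q\times\Sigma_R\times(\Gamma\cup\{\bot\})\to 2^{Q}\cup\{\mathtt{accept}\}$, $\delta_N:Q\times(\Sigma_N\cup\{\lhd\})\times(\Gamma\cup\{\bot\})\to 2^{Q}\cup\{\mathtt{accept}\}$. The computation starts in state $q_0$ on $w\lhd$ with pushdown content $\bot$ and the head at the left end. In state $q$ with topmost pushdown symbol $z$, the automaton skips the letters of $\tau(q)$ from the head position to the right and processes the first symbol $s\notin\tau(q)$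 of the remaining input followed by $\lhd$. If the transition function belonging to $s$ yields $\mathtt{accept}$ on $(q,s,z)$, the input is accepted. Otherwise one of the values is chosen: for $s\in\Sigma_D$ a pair $(q',z')$, where $q'$ is the new state and $z'$ is pushed; for $s\in\Sigma_R$ a new state $q'$, and the topmost pushdown symbol is popped (nothing is popped if it is $\bot$); for $s\in\Sigma_N\cup\{\lhd\}$ a new state $q'$, with the pushdown unchanged. If $s$ is a letter, it is deleted from the input; in the returning mode the head then goes back to the left end of the remaining input, while in the non-returning mode it stays at the position of the deleted letter. If $s=\lhd$, the head goes to the left end in both modes. A word is accepted if some computation on it accepts. The automaton is deterministic if every value of $\delta_D,\delta_R,\delta_N$ (also those at the endmarker) is undefined, $\mathtt{accept}$, or a set with at most one element. Let $\mathscr L(\mathsf{NIDPDAwtl})$ and $\mathscr L(\mathsf{nrNIDPDAwtl})$ be the families of languages accepted by these automata in the returning and in the non-returning mode, and $\mathscr L(\mathsf{DIDPDAwtl})$ and $\mathscr L(\mathsf{nrDIDPDAwtl})$ those accepted by deterministic ones. **Theorem.** $\mathscr L(\mathsf{DIDPDAwtl})$ is properly included in $\mathscr L(\mathsf{NIDPDAwtl})$,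 and $\mathscr L(\mathsf{nrDIDPDAwtl})$ is properly included in $\mathscr L(\mathsf{nrNIDPDAwtl})$. Both are witnessed by the language $L_1\cup L_2$ over $\{a,b,\#\}$, where $L_1$ is the set of all shuffles of $b^n\#b^m$ with $a^n$ for $m,n\ge 1$, and $L_2$ is the set of all shuffles of $b^m\#b^n$ with $a^n$ for $m,n\ge1$: it belongs to $\mathscr L(\mathsf{NIDPDAwtl})$ and to $\mathscr L(\mathsf{nrNIDPDAwtl})$, but neither to $\mathscr L(\mathsf{DIDPDAwtl})$ nor to $\mathscr L(\mathsf{nrDIDPDAwtl})$. -/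

import Mathlib

/-- The effect of an input letter on the pushdown store: the class of the letter in the partition
`Σ = Σ_D ∪ Σ_R ∪ Σ_N`. -/
inductive StackOp where
  /-- `Σ_D`: push one symbol -/
  | push
  /-- `Σ_R`: pop the topmost symbol -/
  | pop
  /-- `Σ_N`: change of state only -/
  | keep

/-- A value of a partial transition function: either `accept` or a set of possible moves.
`moves ∅` also plays the role of an undefined value. -/
inductive Outcome (β : Type) where
  | accept
  | moves (s : Set β)

namespace Outcome

/-- `b` is one of the possible moves. -/
def Allows {β : Type} : Outcome β → β → Prop
  | accept, _ => False
  | moves s, b => b ∈ s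

/-- The value is `accept` or a set of cardinality at most one. -/
def AtMostOne {β : Type} : Outcome β → Prop
  | accept => True
  | moves s => s.Subsingleton

end Outcome

/-- An input-driven pushdown automaton with translucent letters, with input alphabet `A`,
state set `Q` and set of pushdown symbols `Γ`.

A pushdown content `z₁ ⋯ zᵣ ⊥` (top first) is the list `[z₁, …, zᵣ]`; in the argument of type
`Option Γ` the value `none` is the bottom symbol `⊥`. In the argument of type `Option A` of `δN`
the value `none` is the endmarker. The values of `δD`, `δR`, `δN` at letters outside the
respective class of the signature are never used. -/
structure IDPDA (A Q Γ : Type) where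
  /-- the signature, i.e. the partition of the input alphabet -/
  sig : A → StackOp
  /-- the initial state -/
  start : Q
  /-- the translucency mapping -/
  τ : Q → Set A
  /-- transitions on pushing letters -/
  δD : Q → A → Option Γ → Outcome (Q × Γ)
  /-- transitions on popping letters -/
  δR : Q → A → Option Γ → Outcome Q
  /-- transitions on neutral letters and on the endmarker -/
  δN : Q → Option A → Option Γ → Outcome Q

namespace IDPDA

variable {A Q Γ : Type}

/-- Every transition function has at most one possible value, on letters and on the endmarker. -/
def Deterministic (M : IDPDA A Q Γ) : Prop :=
  ∀ (q : Q) (z : Option Γ),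
    (∀ a, M.sig a = StackOp.push → (M.δD q a z).AtMostOne) ∧
    (∀ a, M.sig a = StackOp.pop → (M.δR q a z).AtMostOne) ∧
    (∀ a, M.sig a = StackOp.keep → (M.δN q (some a) z).AtMostOne) ∧
    (M.δN q none z).AtMostOne

/-- `M.Move q a γ q' γ'`: processing the letter `a` in state `q` with pushdown content `γ` may lead
to state `q'` and pushdown content `γ'`. The bottom symbol is never removed
(`List.tail [] = []`). -/
inductive Move (M : IDPDA A Q Γ) : Q → A → List Γ → Q → List Γ → Prop
  | push {q : Q} {a : A} {γ : List Γ} {q' : Q} {z' : Γ} (ha : M.sig a = StackOp.push)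
      (h : (M.δD q a γ.head?).Allows (q', z')) : Move M q a γ q' (z' :: γ)
  | pop {q : Q} {a : A} {γ : List Γ} {q' : Q} (ha : M.sig a = StackOp.pop)
      (h : (M.δR q a γ.head?).Allows q') : Move M q a γ q' γ.tail
  | keep {q : Q} {a : A} {γ : List Γ} {q' : Q} (ha : M.sig a = StackOp.keep)
      (h : (M.δN q (some a) γ.head?).Allows q') : Move M q a γ q' γ

/-- The transition function yields `accept` when the letter `a` is processed in state `q` with
pushdown content `γ`. -/
def AcceptsOn (M : IDPDA A Q Γ) (q : Q) (a : A) (γ : List Γ) : Prop :=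
  match M.sig a with
  | StackOp.push => M.δD q a γ.head? = Outcome.accept
  | StackOp.pop => M.δR q a γ.head? = Outcome.accept
  | StackOp.keep => M.δN q (some a) γ.head? = Outcome.accept

/-- Configurations in the returning mode: state, remaining input, pushdown content. -/
inductive Config (A Q Γ : Type) where
  | run (q : Q) (w : List A) (γ : List Γ)
  | accept

/-- One step in the returning mode: the first visible letter is processed and deleted, and the head
returns to the left end; if no letter is visible, the endmarker is processed. -/
inductive Step (M : IDPDA A Q Γ) : Config A Q Γ → Config A Q Γ → Prop
  | read {q q' : Q} {x y : List A} {a : A} {γ γ' : List Γ}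
      (hx : ∀ c ∈ x, c ∈ M.τ q) (ha : a ∉ M.τ q) (h : M.Move q a γ q' γ') :
      Step M (Config.run q (x ++ a :: y) γ) (Config.run q' (x ++ y) γ')
  | readAccept {q : Q} {x y : List A} {a : A} {γ : List Γ}
      (hx : ∀ c ∈ x, c ∈ M.τ q) (ha : a ∉ M.τ q) (h : M.AcceptsOn q a γ) :
      Step M (Config.run q (x ++ a :: y) γ) Config.accept
  | endmarker {q q' : Q} {x : List A} {γ : List Γ}
      (hx : ∀ c ∈ x, c ∈ M.τ q) (h : (M.δN q none γ.head?).Allows q') :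
      Step M (Config.run q x γ) (Config.run q' x γ)
  | endAccept {q : Q} {x : List A} {γ : List Γ}
      (hx : ∀ c ∈ x, c ∈ M.τ q) (h : M.δN q none γ.head? = Outcome.accept) :
      Step M (Config.run q x γ) Config.accept

/-- The language accepted in the returning mode. -/
def lang (M : IDPDA A Q Γ) : Language A :=
  {w | Relation.ReflTransGen M.Step (Config.run M.start w []) Config.accept}

/-- Configurations in the non-returning mode: remaining input to the left of the head, state,
remaining input to the right of the head, pushdown content. -/
inductive NRConfig (A Q Γ : Type) where
  | run (u : List A) (q : Q) (w : List A) (γ : List Γ)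
  | accept

/-- One step in the non-returning mode: the first visible letter to the right of the head is
processed and deleted, and the head stays there; if no letter to the right of the head is visible,
the endmarker is processed and the head returns to the left end. -/
inductive NRStep (M : IDPDA A Q Γ) : NRConfig A Q Γ → NRConfig A Q Γ → Prop
  | read {q q' : Q} {u x y : List A} {a : A} {γ γ' : List Γ}
      (hx : ∀ c ∈ x, c ∈ M.τ q) (ha : a ∉ M.τ q) (h : M.Move q a γ q' γ') :
      NRStep M (NRConfig.run u q (x ++ a :: y) γ) (NRConfig.run (u ++ x) q' y γ')
  | readAccept {q : Q} {u x y : List A} {a : A} {γ : List Γ}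
      (hx : ∀ c ∈ x, c ∈ M.τ q) (ha : a ∉ M.τ q) (h : M.AcceptsOn q a γ) :
      NRStep M (NRConfig.run u q (x ++ a :: y) γ) NRConfig.accept
  | endmarker {q q' : Q} {u x : List A} {γ : List Γ}
      (hx : ∀ c ∈ x, c ∈ M.τ q) (h : (M.δN q none γ.head?).Allows q') :
      NRStep M (NRConfig.run u q x γ) (NRConfig.run [] q' (u ++ x) γ)
  | endAccept {q : Q} {u x : List A} {γ : List Γ}
      (hx : ∀ c ∈ x, c ∈ M.τ q) (h : M.δN q none γ.head? = Outcome.accept) :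
      NRStep M (NRConfig.run u q x γ) NRConfig.accept

/-- The language accepted in the non-returning mode. -/
def nrLang (M : IDPDA A Q Γ) : Language A :=
  {w | Relation.ReflTransGen M.NRStep (NRConfig.run [] M.start w []) NRConfig.accept}

end IDPDA

/-- A language family assigns to every alphabet a set of languages over it; only its values at
finite alphabets are relevant. -/
abbrev LanguageFamily := (A : Type) → Set (Language A)

/-- Languages accepted by nondeterministic automata in the returning mode. -/
def NIDPDAwtl : LanguageFamily := fun A =>
  {L | ∃ (Q Γ : Type) (_ : Finite Q) (_ : Finite Γ) (M : IDPDA A Q Γ), M.lang = L}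

/-- Languages accepted by deterministic automata in the returning mode. -/
def DIDPDAwtl : LanguageFamily := fun A =>
  {L | ∃ (Q Γ : Type) (_ : Finite Q) (_ : Finite Γ) (M : IDPDA A Q Γ),
    M.Deterministic ∧ M.lang = L}

/-- Languages accepted by nondeterministic automata in the non-returning mode. -/
def nrNIDPDAwtl : LanguageFamily := fun A =>
  {L | ∃ (Q Γ : Type) (_ : Finite Q) (_ : Finite Γ) (M : IDPDA A Q Γ), M.nrLang = L}

/-- Languages accepted by deterministic automata in the non-returning mode. -/
def nrDIDPDAwtl : LanguageFamily := fun A =>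
  {L | ∃ (Q Γ : Type) (_ : Finite Q) (_ : Finite Γ) (M : IDPDA A Q Γ),
    M.Deterministic ∧ M.nrLang = L}

/-- `F` is properly included in `G`. -/
def ProperlyIncluded (F G : LanguageFamily) : Prop :=
  (∀ (A : Type) [Finite A], F A ⊆ G A) ∧
    ∃ (A : Type) (_ : Finite A), ∃ L ∈ G A, L ∉ F A

/-- The shuffle `{x₁y₁⋯xₙyₙ | x₁⋯xₙ ∈ L₁, y₁⋯yₙ ∈ L₂}` of two languages. -/
def shuffle {A : Type} (L₁ L₂ : Language A) : Language A :=
  {w | ∃ p : List (List A × List A), (p.map Prod.fst).flatten ∈ L₁ ∧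
    (p.map Prod.snd).flatten ∈ L₂ ∧ w = (p.map fun xy => xy.1 ++ xy.2).flatten}

/-- The alphabet `{a, b, #}`. -/
inductive Letter where
  | a
  | b
  | hash
  deriving DecidableEq

instance : Fintype Letter :=
  ⟨{Letter.a, Letter.b, Letter.hash}, by intro x; cases x <;> simp⟩

/-- `L₁ = {bⁿ # bᵐ ⧢ aⁿ | m, n ≥ 1}` -/
def witness₁ : Language Letter :=
  {w | ∃ m n : ℕ, 1 ≤ m ∧ 1 ≤ n ∧
    w ∈ shuffle {List.replicate n Letter.b ++ [Letter.hash] ++ List.replicate m Letter.b}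
      {List.replicate n Letter.a}}

/-- `L₂ = {bᵐ # bⁿ ⧢ aⁿ | m, n ≥ 1}` -/
def witness₂ : Language Letter :=
  {w | ∃ m n : ℕ, 1 ≤ m ∧ 1 ≤ n ∧
    w ∈ shuffle {List.replicate m Letter.b ++ [Letter.hash] ++ List.replicate n Letter.b}
      {List.replicate n Letter.a}}

/-- `L₁ ∪ L₂`, the sum of languages being their union -/
def witness : Language Letter := witness₁ + witness₂

/-! A nondeterministic automaton guesses which block of `b`s matches the `a`s and then deletes a `b`
and an `a` alternately; it needs no pushdown. Returning automata are simulated by non-returning ones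
(`rewind`), so it remains to refute deterministic non-returning automata, and the words aᵏ bⁱ # bʲ
suffice for this.

On such words every step deletes the first letter of a block, and the step depends on the block
lengths only through the set of nonempty blocks (`nrStep_iff`). As long as no block is exhausted
there is thus one run common to all lengths. `Decides` expresses that a configuration, reached after
`off` letters of the blocks have been read, still has to give the right answer for all remaining
lengths. A configuration that decides for two offsets forces the same answers for both, and every
contradiction is a pigeonhole argument of this kind.

If the common run reads infinitely many `a`s (`not_read_a_forever`), the configuration after the
last `a` has to determine k. If `b` does not pop, only state and two pushdown symbols matter. If `b`
pops and the pushdown is empty infinitely often, the run is periodic. Otherwise the height is at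
most the number of `a`s minus the number of `b`s read, up to a constant; then for large k the
separator must be read before the pushdown is emptied, a return to the left end would merge the two
`b`-blocks, and so the second block empties the pushdown and the information is lost
(`not_decides_pop`).

Otherwise only one `b`-block is read from some time on (`not_read_forever`): the first one, or, once
the separator has been read, the second one, again because a return would merge the blocks. If `b`
does not push, a bounded pushdown cannot hold the length of this block. If `b` pushes, two moments
with the same state and topmost symbol yield configurations that differ only in the bottom part of
the pushdown. To tell them apart the automaton has to uncover this part by popping essentially with
`a`s only, and it arrives at bounded height with an unbounded excess of `a`s over letters of the
other `b`-block (`exists_low`, `not_decides_push`). -/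

/-! ### Deterministic steps as functions -/

/-- The result of a step of a deterministic machine. -/
inductive StepResult (β : Type) where
  | accept
  | stuck
  | go (b : β)

namespace StepResult

variable {β β' : Type}

def map (f : β → β') : StepResult β → StepResult β'
  | accept => accept
  | stuck => stuck
  | go b => go (f b)

@[simp] lemma map_eq_accept {f : β → β'} {r : StepResult β} : r.map f = accept ↔ r = accept := by
  cases r <;> simp [map]

@[simp] lemma map_eq_go {f : β → β'} {r : StepResult β} {b : β'} :
    r.map f = go b ↔ ∃ a, r = go a ∧ f a = b := by
  cases r <;> simp [map]

lemma map_map {β'' : Type} (f : β → β') (g : β' → β'') (r : StepResult β) :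
    (r.map f).map g = r.map fun b => g (f b) := by
  cases r <;> rfl

end StepResult

namespace Outcome

variable {β : Type}

open Classical in
/-- The step prescribed by a value of a deterministic transition function. -/
noncomputable def result : Outcome β → StepResult β
  | accept => StepResult.accept
  | moves s => if h : s.Nonempty then StepResult.go h.some else StepResult.stuck

lemma result_eq_accept {o : Outcome β} : o.result = StepResult.accept ↔ o = accept := by
  cases o with
  | accept => simp [result]
  | moves s => by_cases h : s.Nonempty <;> simp [result, h]

lemma AtMostOne.allows_iff {o : Outcome β} (ho : o.AtMostOne) {b : β} :
    o.Allows b ↔ o.result = StepResult.go b := by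
  cases o with
  | accept => simp [result, Allows]
  | moves s =>
    by_cases h : s.Nonempty
    · simp only [result, Allows, h, dite_true, StepResult.go.injEq]
      exact ⟨fun hb => ho h.some_mem hb, fun hb => hb ▸ h.some_mem⟩
    · simp only [result, Allows, h, dite_false, reduceCtorEq, iff_false]
      exact fun hb => h ⟨b, hb⟩

end Outcome

/-- With `P` the translucent letters, this makes the processed letter unique. -/
lemma append_cons_unique {A : Type} {P : A → Prop} {x x' y y' : List A} {a a' : A}
    (h : x ++ a :: y = x' ++ a' :: y') (hx : ∀ c ∈ x, P c) (ha : ¬ P a)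
    (hx' : ∀ c ∈ x', P c) (ha' : ¬ P a') : x = x' ∧ a = a' ∧ y = y' := by
  induction x generalizing x' with
  | nil =>
    cases x' with
    | nil => simpa using h
    | cons c x' =>
      simp only [List.nil_append, List.cons_append, List.cons.injEq] at h
      exact absurd (hx' c (by simp)) (h.1 ▸ ha)
  | cons c x ih =>
    cases x' with
    | nil =>
      simp only [List.nil_append, List.cons_append, List.cons.injEq] at h
      exact absurd (hx c (by simp)) (h.1 ▸ ha')
    | cons c' x' =>
      simp only [List.cons_append, List.cons.injEq] at h
      obtain ⟨rfl, h⟩ := h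
      obtain ⟨rfl, h2⟩ := ih h (fun c hc => hx c (by simp [hc])) (fun c hc => hx' c (by simp [hc]))
      exact ⟨rfl, h2⟩

namespace IDPDA

variable {A Q Γ : Type}

/-- The effect of processing a letter or the endmarker on state and pushdown. -/
noncomputable def act (M : IDPDA A Q Γ) (q : Q) (s : Option A) (γ : List Γ) :
    StepResult (Q × List Γ) :=
  match s with
  | none => (M.δN q none γ.head?).result.map fun q' => (q', γ)
  | some a =>
    match M.sig a with
    | StackOp.push => (M.δD q a γ.head?).result.map fun r => (r.1, r.2 :: γ)
    | StackOp.pop => (M.δR q a γ.head?).result.map fun q' => (q', γ.tail)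
    | StackOp.keep => (M.δN q (some a) γ.head?).result.map fun q' => (q', γ)

lemma acceptsOn_iff {M : IDPDA A Q Γ} {q : Q} {a : A} {γ : List Γ} :
    M.AcceptsOn q a γ ↔ M.act q (some a) γ = StepResult.accept := by
  unfold AcceptsOn act
  rcases h : M.sig a <;> simp [h, Outcome.result_eq_accept]

lemma Deterministic.move_iff {M : IDPDA A Q Γ} (hM : M.Deterministic) {q q' : Q} {a : A}
    {γ γ' : List Γ} : M.Move q a γ q' γ' ↔ M.act q (some a) γ = StepResult.go (q', γ') := by
  have hq := hM q γ.head?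
  constructor
  · rintro (⟨ha, h⟩ | ⟨ha, h⟩ | ⟨ha, h⟩)
    · rw [(hq.1 a ha).allows_iff] at h
      simp [act, ha, h]
    · rw [(hq.2.1 a ha).allows_iff] at h
      simp [act, ha, h]
    · rw [(hq.2.2.1 a ha).allows_iff] at h
      simp [act, ha, h]
  · intro h
    rcases ha : M.sig a with _ | _ | _ <;> simp only [act, ha, StepResult.map_eq_go] at h
    · obtain ⟨⟨q₁, z⟩, h, h'⟩ := h
      obtain ⟨rfl, rfl⟩ := Prod.mk.inj h'
      exact Move.push ha ((hq.1 a ha).allows_iff.2 h)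
    · obtain ⟨q₁, h, h'⟩ := h
      obtain ⟨rfl, rfl⟩ := Prod.mk.inj h'
      exact Move.pop ha ((hq.2.1 a ha).allows_iff.2 h)
    · obtain ⟨q₁, h, h'⟩ := h
      obtain ⟨rfl, rfl⟩ := Prod.mk.inj h'
      exact Move.keep ha ((hq.2.2.1 a ha).allows_iff.2 h)

lemma act_none_eq_accept {M : IDPDA A Q Γ} {q : Q} {γ : List Γ} :
    M.act q none γ = StepResult.accept ↔ M.δN q none γ.head? = Outcome.accept := by
  simp [act, Outcome.result_eq_accept]

lemma Deterministic.allows_none_iff {M : IDPDA A Q Γ} (hM : M.Deterministic) {q q' : Q}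
    {γ : List Γ} :
    (M.δN q none γ.head?).Allows q' ↔ M.act q none γ = StepResult.go (q', γ) := by
  rw [(hM q γ.head?).2.2.2.allows_iff]
  simp [act]

lemma act_none_stack {M : IDPDA A Q Γ} {q q' : Q} {γ γ' : List Γ}
    (h : M.act q none γ = StepResult.go (q', γ')) : γ' = γ := by
  simp only [act, StepResult.map_eq_go, Prod.mk.injEq] at h
  obtain ⟨_, _, _, h⟩ := h
  exact h.symm

/-- Only the topmost pushdown symbol is inspected. -/
lemma act_append (M : IDPDA A Q Γ) (q : Q) (s : Option A) {g : List Γ} (hg : g ≠ [])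
    (ρ : List Γ) :
    M.act q s (g ++ ρ) = (M.act q s g).map fun r => (r.1, r.2 ++ ρ) := by
  obtain ⟨z, g, rfl⟩ := List.exists_cons_of_ne_nil hg
  rcases s with _ | a
  · simp [act, StepResult.map_map]
  · rcases ha : M.sig a <;> simp [act, ha, StepResult.map_map]

lemma act_push_length {M : IDPDA A Q Γ} {q q' : Q} {a : A} {γ γ' : List Γ}
    (ha : M.sig a = StackOp.push) (h : M.act q (some a) γ = StepResult.go (q', γ')) :
    ∃ z, γ' = z :: γ := by
  simp only [act, ha, StepResult.map_eq_go, Prod.mk.injEq] at h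
  obtain ⟨r, -, -, h⟩ := h
  exact ⟨_, h.symm⟩

lemma act_pop {M : IDPDA A Q Γ} {q q' : Q} {a : A} {γ γ' : List Γ}
    (ha : M.sig a = StackOp.pop) (h : M.act q (some a) γ = StepResult.go (q', γ')) :
    γ' = γ.tail := by
  simp only [act, ha, StepResult.map_eq_go, Prod.mk.injEq] at h
  obtain ⟨r, -, -, h⟩ := h
  exact h.symm

lemma act_keep {M : IDPDA A Q Γ} {q q' : Q} {a : A} {γ γ' : List Γ}
    (ha : M.sig a = StackOp.keep) (h : M.act q (some a) γ = StepResult.go (q', γ')) :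
    γ' = γ := by
  simp only [act, ha, StepResult.map_eq_go, Prod.mk.injEq] at h
  obtain ⟨r, -, -, h⟩ := h
  exact h.symm

lemma act_length_le {M : IDPDA A Q Γ} {q q' : Q} {s : Option A} {γ γ' : List Γ}
    (h : M.act q s γ = StepResult.go (q', γ')) : γ'.length ≤ γ.length + 1 := by
  rcases s with _ | a
  · simp [act_none_stack h]
  · rcases ha : M.sig a
    · obtain ⟨z, rfl⟩ := act_push_length ha h
      simp
    · simp [act_pop ha h]; omega
    · simp [act_keep ha h]

lemma le_act_length {M : IDPDA A Q Γ} {q q' : Q} {s : Option A} {γ γ' : List Γ}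
    (h : M.act q s γ = StepResult.go (q', γ')) : γ.length ≤ γ'.length + 1 := by
  rcases s with _ | a
  · simp [act_none_stack h]
  · rcases ha : M.sig a
    · obtain ⟨z, rfl⟩ := act_push_length ha h
      simp; omega
    · simp [act_pop ha h]; omega
    · simp [act_keep ha h]

lemma le_act_length_of_ne_pop {M : IDPDA A Q Γ} {q q' : Q} {a : A} {γ γ' : List Γ}
    (ha : M.sig a ≠ StackOp.pop)
    (h : M.act q (some a) γ = StepResult.go (q', γ')) : γ.length ≤ γ'.length := by
  rcases ha' : M.sig a
  · obtain ⟨z, rfl⟩ := act_push_length ha' h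
    simp
  · exact absurd ha' ha
  · simp [act_keep ha' h]

lemma act_length_le_of_ne_push {M : IDPDA A Q Γ} {q q' : Q} {a : A} {γ γ' : List Γ}
    (ha : M.sig a ≠ StackOp.push)
    (h : M.act q (some a) γ = StepResult.go (q', γ')) : γ'.length ≤ γ.length := by
  rcases ha' : M.sig a
  · exact absurd ha' ha
  · simp [act_pop ha' h]
  · simp [act_keep ha' h]

end IDPDA

/-! ### Words in four blocks and the automaton on them -/

/-- The letters of the four blocks of the words `aᵏ bⁱ # bʲ`. -/
def blockLetter : Fin 4 → Letter := ![Letter.a, Letter.b, Letter.hash, Letter.b]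

/-- The part of the word `aᵏ bⁱ #ʰ bʲ` with `v = (k, i, h, j)` given by a list of blocks. -/
def blocks (v : Fin 4 → ℕ) (l : List (Fin 4)) : List Letter :=
  l.flatMap fun n => List.replicate (v n) (blockLetter n)

/-- The input to the left of a head standing at the left end of block `p`; `blocksFrom` is the input
to its right. -/
def blocksBefore (v : Fin 4 → ℕ) (p : Fin 4) : List Letter :=
  blocks v ((List.finRange 4).take p)

def blocksFrom (v : Fin 4 → ℕ) (p : Fin 4) : List Letter :=
  blocks v ((List.finRange 4).drop p)

def blocksBetween (v : Fin 4 → ℕ) (p n : Fin 4) : List Letter :=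
  blocks v (((List.finRange 4).take n).drop p)

/-- Removal of one letter of a block, or of none. -/
def consume (v : Fin 4 → ℕ) (e : Option (Fin 4)) : Fin 4 → ℕ :=
  e.elim v fun n => Function.update v n (v n - 1)

lemma mem_blocks {v : Fin 4 → ℕ} {l : List (Fin 4)} {c : Letter} :
    c ∈ blocks v l ↔ ∃ n ∈ l, v n ≠ 0 ∧ blockLetter n = c := by
  simp only [blocks, List.mem_flatMap, List.mem_replicate]
  exact ⟨fun ⟨n, h, h1, h2⟩ => ⟨n, h, h1, h2.symm⟩, fun ⟨n, h, h1, h2⟩ => ⟨n, h, h1, h2.symm⟩⟩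

lemma mem_blocksBetween {v : Fin 4 → ℕ} {p n : Fin 4} {c : Letter} :
    c ∈ blocksBetween v p n ↔ ∃ m, p ≤ m ∧ m < n ∧ v m ≠ 0 ∧ blockLetter m = c := by
  rw [blocksBetween, mem_blocks]
  have : ∀ p n m : Fin 4, m ∈ ((List.finRange 4).take n).drop p ↔ p ≤ m ∧ m < n := by decide
  simp only [this, and_assoc]

lemma mem_blocksFrom {v : Fin 4 → ℕ} {p : Fin 4} {c : Letter} :
    c ∈ blocksFrom v p ↔ ∃ m, p ≤ m ∧ v m ≠ 0 ∧ blockLetter m = c := by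
  rw [blocksFrom, mem_blocks]
  have : ∀ p m : Fin 4, m ∈ (List.finRange 4).drop p ↔ p ≤ m := by decide
  simp only [this]

lemma blocks_append (v : Fin 4 → ℕ) (l l' : List (Fin 4)) :
    blocks v (l ++ l') = blocks v l ++ blocks v l' := by
  simp [blocks]

lemma blocks_update {v : Fin 4 → ℕ} {l : List (Fin 4)} {n : Fin 4} (hn : n ∉ l) (k : ℕ) :
    blocks (Function.update v n k) l = blocks v l := by
  induction l with
  | nil => rfl
  | cons m l ih =>
    simp only [List.mem_cons, not_or] at hn
    have := ih hn.2
    simp only [blocks, List.flatMap_cons] at this ⊢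
    rw [this, Function.update_of_ne (Ne.symm hn.1)]

/-- The deleted letter is the first one of its block, so the head ends up at the left end of the
rest of that block. Hence a block number suffices as head position. -/
lemma blocksFrom_eq {v : Fin 4 → ℕ} {p n : Fin 4} (h : p ≤ n) (hv : v n ≠ 0) :
    blocksFrom v p =
      blocksBetween v p n ++ blockLetter n :: blocksFrom (consume v (some n)) n := by
  have h1 : ∀ p n : Fin 4, p ≤ n → (List.finRange 4).drop p =
    ((List.finRange 4).take n).drop p ++ n :: (List.finRange 4).drop (n + 1) := by decide
  have h2 : ∀ n : Fin 4, (List.finRange 4).drop n = n :: (List.finRange 4).drop (n + 1) := by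
    decide
  have h3 : ∀ n : Fin 4, n ∉ (List.finRange 4).drop (n + 1) := by decide
  obtain ⟨k, hk⟩ := Nat.exists_eq_succ_of_ne_zero hv
  rw [blocksFrom, h1 p n h, blocks_append, blocksBetween, blocksFrom, h2 n]
  congr 1
  have := blocks_update (v := v) (h3 n) k
  simp only [blocks, List.flatMap_cons] at this ⊢
  simp [consume, hk, List.replicate_succ, this]

lemma blocksBefore_append {v : Fin 4 → ℕ} {p n : Fin 4} (h : p ≤ n) :
    blocksBefore v p ++ blocksBetween v p n = blocksBefore (consume v (some n)) n := by
  have h1 : ∀ p n : Fin 4, p ≤ n → (List.finRange 4).take n =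
    (List.finRange 4).take p ++ ((List.finRange 4).take n).drop p := by decide
  have h2 : ∀ n : Fin 4, n ∉ (List.finRange 4).take n := by decide
  simp only [consume, Option.elim]
  rw [blocksBefore, blocksBetween, blocksBefore, blocks_update (h2 n), ← blocks_append, ← h1 p n h]

lemma blocksBefore_append_blocksFrom (v : Fin 4 → ℕ) (p : Fin 4) :
    blocksBefore v p ++ blocksFrom v p = blocksFrom v 0 := by
  rw [blocksBefore, blocksFrom, ← blocks_append, List.take_append_drop]
  rfl

open Classical in
/-- The first of the nonempty blocks `F` from `p` on whose letter is not in `T`. -/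
noncomputable def firstVisible (T : Set Letter) (F : Finset (Fin 4)) (p : Fin 4) :
    Option (Fin 4) :=
  (List.finRange 4).find? fun n => p ≤ n ∧ n ∈ F ∧ blockLetter n ∉ T

lemma firstVisible_eq_none {T : Set Letter} {F : Finset (Fin 4)} {p : Fin 4} :
    firstVisible T F p = none ↔ ∀ n, p ≤ n → n ∈ F → blockLetter n ∈ T := by
  simp [firstVisible]

lemma firstVisible_eq_some {T : Set Letter} {F : Finset (Fin 4)} {p n : Fin 4}
    (h : firstVisible T F p = some n) :
    p ≤ n ∧ n ∈ F ∧ blockLetter n ∉ T ∧ ∀ m, p ≤ m → m < n → m ∈ F → blockLetter m ∈ T := by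
  have h1 := List.find?_some h
  simp only [decide_eq_true_eq] at h1
  refine ⟨h1.1, h1.2.1, h1.2.2, fun m hm hmn hF => ?_⟩
  by_contra hT
  rw [firstVisible, List.find?_eq_some_iff_append] at h
  obtain ⟨-, as, bs, has, hall⟩ := h
  have hsort : (as ++ n :: bs).Pairwise (· < ·) := has ▸ List.pairwise_lt_finRange 4
  have hmem : m ∈ as ++ n :: bs := has ▸ List.mem_finRange m
  rw [List.pairwise_append] at hsort
  rcases List.mem_append.1 hmem with hm' | hm'
  · simpa [hm, hF, hT] using hall m hm'
  · rcases List.mem_cons.1 hm' with rfl | hm'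
    · exact lt_irrefl _ hmn
    · exact absurd ((List.pairwise_cons.1 hsort.2.1).1 m hm') (not_lt_of_gt hmn)

def nonemptyBlocks (v : Fin 4 → ℕ) : Finset (Fin 4) := Finset.univ.filter fun n => v n ≠ 0

@[simp] lemma mem_nonemptyBlocks {v : Fin 4 → ℕ} {n : Fin 4} :
    n ∈ nonemptyBlocks v ↔ v n ≠ 0 := by
  simp [nonemptyBlocks]

/-- A configuration on a block word, up to the lengths of the blocks: the head stands at the
left end of the block `pos`. -/
@[ext] structure BlockConfig (Q Γ : Type) where
  pos : Fin 4
  state : Q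
  stack : List Γ

namespace IDPDA

variable {Q Γ : Type}

/-- One step if the nonempty blocks are those in `F`: the block from which a letter is deleted
(`none` for the endmarker) and the next configuration. -/
noncomputable def advance (M : IDPDA Letter Q Γ) (F : Finset (Fin 4)) (c : BlockConfig Q Γ) :
    StepResult (Option (Fin 4) × BlockConfig Q Γ) :=
  let e := firstVisible (M.τ c.state) F c.pos
  -- The default `0` is the return to the left end after the endmarker.
  (M.act c.state (e.map blockLetter) c.stack).map fun r => (e, ⟨e.getD 0, r.1, r.2⟩)

/-- Acceptance within `t` steps. -/
def acceptsIn (M : IDPDA Letter Q Γ) : ℕ → BlockConfig Q Γ → (Fin 4 → ℕ) → Prop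
  | 0, _, _ => False
  | t + 1, c, v =>
    match M.advance (nonemptyBlocks v) c with
    | StepResult.accept => True
    | StepResult.stuck => False
    | StepResult.go r => acceptsIn M t r.2 (consume v r.1)

def accepts (M : IDPDA Letter Q Γ) (c : BlockConfig Q Γ) (v : Fin 4 → ℕ) : Prop :=
  ∃ t, M.acceptsIn t c v

lemma accepts_iff (M : IDPDA Letter Q Γ) (c : BlockConfig Q Γ) (v : Fin 4 → ℕ) :
    M.accepts c v ↔ match M.advance (nonemptyBlocks v) c with
    | StepResult.accept => True
    | StepResult.stuck => False
    | StepResult.go r => M.accepts r.2 (consume v r.1) := by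
  constructor
  · rintro ⟨t, h⟩
    cases t with
    | zero => exact h.elim
    | succ t =>
      rw [acceptsIn] at h
      rcases h' : M.advance (nonemptyBlocks v) c with _ | _ | r <;> rw [h'] at h
      · trivial
      · exact h
      · exact ⟨t, h⟩
  · intro h
    rcases h' : M.advance (nonemptyBlocks v) c with _ | _ | r <;> rw [h'] at h
    · exact ⟨1, by simp [acceptsIn, h']⟩
    · exact h.elim
    · obtain ⟨t, h⟩ := h
      exact ⟨t + 1, by simpa [acceptsIn, h'] using h⟩

lemma accepts_go {M : IDPDA Letter Q Γ} {c : BlockConfig Q Γ} {v : Fin 4 → ℕ}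
    {r : Option (Fin 4) × BlockConfig Q Γ}
    (h : M.advance (nonemptyBlocks v) c = StepResult.go r) :
    M.accepts c v ↔ M.accepts r.2 (consume v r.1) := by
  rw [accepts_iff, h]

/-- The configuration of the automaton that a block configuration stands for. -/
def toNR (c : BlockConfig Q Γ) (v : Fin 4 → ℕ) : NRConfig Letter Q Γ :=
  NRConfig.run (blocksBefore v c.pos) c.state (blocksFrom v c.pos) c.stack

/-- The right-hand side sees the lengths only through `nonemptyBlocks v`. Hence runs on different
lengths coincide until one of them exhausts a block. -/
lemma Deterministic.nrStep_iff {M : IDPDA Letter Q Γ} (hM : M.Deterministic)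
    (c : BlockConfig Q Γ) (v : Fin 4 → ℕ) (d : NRConfig Letter Q Γ) :
    M.NRStep (toNR c v) d ↔ match M.advance (nonemptyBlocks v) c with
    | StepResult.accept => d = NRConfig.accept
    | StepResult.stuck => False
    | StepResult.go r => d = toNR r.2 (consume v r.1) := by
  obtain ⟨p, q, γ⟩ := c
  unfold toNR advance
  rcases he : firstVisible (M.τ q) (nonemptyBlocks v) p with _ | n
  · have hall : ∀ c ∈ blocksFrom v p, c ∈ M.τ q := by
      intro c hc
      obtain ⟨m, hm, hv, rfl⟩ := mem_blocksFrom.1 hc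
      exact firstVisible_eq_none.1 he m hm (by simpa using hv)
    have hnot : ∀ {x y : List Letter} {s : Letter}, blocksFrom v p = x ++ s :: y →
        s ∉ M.τ q → False := fun h ha => ha (hall _ (by simp [h]))
    simp only [Option.map_none, Option.getD_none]
    constructor
    · generalize hw : blocksFrom v p = w at hall hnot
      intro h
      cases h with
      | read hx ha h => exact (hnot rfl ha).elim
      | readAccept hx ha h => exact (hnot rfl ha).elim
      | endmarker hx h =>
        rw [hM.allows_none_iff] at h
        simp only [h, StepResult.map, consume, Option.elim, ← hw, blocksBefore_append_blocksFrom]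
        rfl
      | endAccept hx h =>
        rw [← act_none_eq_accept] at h
        simp [h, StepResult.map]
    · intro h
      rcases ha : M.act q none γ with _ | _ | r <;> simp only [ha, StepResult.map] at h
      · subst h
        exact NRStep.endAccept hall (act_none_eq_accept.1 ha)
      · obtain ⟨q', γ'⟩ := r
        obtain rfl := act_none_stack ha
        have := NRStep.endmarker (u := blocksBefore v p) hall (hM.allows_none_iff.2 ha)
        rw [blocksBefore_append_blocksFrom] at this
        rw [h]
        exact this
  · obtain ⟨hpn, hF, hT, hlt⟩ := firstVisible_eq_some he
    rw [mem_nonemptyBlocks] at hF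
    have hx : ∀ c ∈ blocksBetween v p n, c ∈ M.τ q := by
      intro c hc
      obtain ⟨m, h1, h2, h3, rfl⟩ := mem_blocksBetween.1 hc
      exact hlt m h1 h2 (by simpa using h3)
    simp only [Option.map_some, Option.getD_some]
    rw [blocksFrom_eq hpn hF]
    constructor
    · generalize hw : blocksBetween v p n ++
        blockLetter n :: blocksFrom (consume v (some n)) n = w
      intro h
      cases h with
      | read hx' ha' h =>
        obtain ⟨rfl, rfl, rfl⟩ := append_cons_unique hw hx hT hx' ha'
        rw [hM.move_iff] at h
        simp only [h, StepResult.map, blocksBefore_append hpn]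
      | readAccept hx' ha' h =>
        obtain ⟨rfl, rfl, rfl⟩ := append_cons_unique hw hx hT hx' ha'
        rw [acceptsOn_iff] at h
        simp [h, StepResult.map]
      | endmarker hx' h => exact (hT (hx' _ (by simp [← hw]))).elim
      | endAccept hx' h => exact (hT (hx' _ (by simp [← hw]))).elim
    · intro h
      rcases ha : M.act q (some (blockLetter n)) γ with _ | _ | r <;>
        simp only [ha, StepResult.map] at h
      · subst h
        exact NRStep.readAccept hx hT (acceptsOn_iff.2 ha)
      · rw [h, ← blocksBefore_append hpn]
        exact NRStep.read hx hT (hM.move_iff.2 ha)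

lemma Deterministic.accepts_iff_reach {M : IDPDA Letter Q Γ} (hM : M.Deterministic)
    (c : BlockConfig Q Γ) (v : Fin 4 → ℕ) :
    M.accepts c v ↔ Relation.ReflTransGen M.NRStep (toNR c v) NRConfig.accept := by
  constructor
  · rintro ⟨t, h⟩
    induction t generalizing c v with
    | zero => exact h.elim
    | succ t ih =>
      have hs := hM.nrStep_iff c v
      rw [acceptsIn] at h
      rcases h' : M.advance (nonemptyBlocks v) c with _ | _ | r <;> rw [h'] at h <;>
        simp only [h'] at hs
      · exact Relation.ReflTransGen.single ((hs _).2 rfl)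
      · exact h.elim
      · exact Relation.ReflTransGen.head ((hs _).2 rfl) (ih _ _ h)
  · intro h
    generalize hx : toNR c v = x at h
    induction h using Relation.ReflTransGen.head_induction_on generalizing c v with
    | refl => simp [toNR] at hx
    | head h h' ih =>
      subst hx
      rw [hM.nrStep_iff] at h
      rw [accepts_iff]
      rcases h' : M.advance (nonemptyBlocks v) c with _ | _ | r <;> simp only [h'] at h
      · trivial
      · exact ih _ _ h.symm

/-- If the separator has been read, then only the total length of the `b`-blocks matters at the
left end. -/
lemma Deterministic.accepts_merge {M : IDPDA Letter Q Γ} (hM : M.Deterministic) {q : Q}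
    {γ : List Γ} {v v' : Fin 4 → ℕ} (h0 : v 0 = v' 0) (h2 : v 2 = 0) (h2' : v' 2 = 0)
    (h : v 1 + v 3 = v' 1 + v' 3) : M.accepts ⟨0, q, γ⟩ v ↔ M.accepts ⟨0, q, γ⟩ v' := by
  rw [hM.accepts_iff_reach, hM.accepts_iff_reach]
  have hw : ∀ u : Fin 4 → ℕ, u 2 = 0 → toNR ⟨0, q, γ⟩ u = NRConfig.run [] q
      (List.replicate (u 0) Letter.a ++ List.replicate (u 1 + u 3) Letter.b) γ := by
    intro u hu
    have : List.finRange 4 = [0, 1, 2, 3] := by decide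
    simp [toNR, blocksBefore, blocksFrom, blocks, this, hu, blockLetter]
  rw [hw v h2, hw v' h2', h0, h]

end IDPDA

/-! ### Reachable blocks and the reachable part of the pushdown -/

namespace IDPDA

variable {Q Γ : Type}

lemma advance_eq_go {M : IDPDA Letter Q Γ} {F : Finset (Fin 4)} {c c' : BlockConfig Q Γ}
    {e : Option (Fin 4)} (h : M.advance F c = StepResult.go (e, c')) :
    firstVisible (M.τ c.state) F c.pos = e ∧ c'.pos = e.getD 0 ∧
      M.act c.state (e.map blockLetter) c.stack = StepResult.go (c'.state, c'.stack) := by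
  simp only [advance, StepResult.map_eq_go, Prod.mk.injEq] at h
  obtain ⟨r, hr, rfl, rfl⟩ := h
  exact ⟨rfl, rfl, hr⟩

lemma advance_mem {M : IDPDA Letter Q Γ} {F : Finset (Fin 4)} {c c' : BlockConfig Q Γ}
    {n : Fin 4} (h : M.advance F c = StepResult.go (some n, c')) : n ∈ F :=
  (firstVisible_eq_some (advance_eq_go h).1).2.1

lemma advance_pos_le {M : IDPDA Letter Q Γ} {F : Finset (Fin 4)} {c c' : BlockConfig Q Γ}
    {n : Fin 4} (h : M.advance F c = StepResult.go (some n, c')) : c.pos ≤ n :=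
  (firstVisible_eq_some (advance_eq_go h).1).1

lemma advance_pos {M : IDPDA Letter Q Γ} {F : Finset (Fin 4)} {c c' : BlockConfig Q Γ}
    {e : Option (Fin 4)} (h : M.advance F c = StepResult.go (e, c')) : c'.pos = e.getD 0 :=
  (advance_eq_go h).2.1

/-- The second `b`-block cannot be reached from the left of a nonempty first one. -/
lemma advance_ne_three {M : IDPDA Letter Q Γ} {F : Finset (Fin 4)} {c c' : BlockConfig Q Γ}
    (h1 : 1 ∈ F) (hp : c.pos ≤ 1) : M.advance F c ≠ StepResult.go (some 3, c') := by
  intro h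
  have := firstVisible_eq_some (advance_eq_go h).1
  exact this.2.2.1 (this.2.2.2 1 hp (by decide) h1)

lemma advance_stack_none {M : IDPDA Letter Q Γ} {F : Finset (Fin 4)} {c c' : BlockConfig Q Γ}
    (h : M.advance F c = StepResult.go (none, c')) : c'.stack = c.stack :=
  act_none_stack (advance_eq_go h).2.2

lemma advance_append (M : IDPDA Letter Q Γ) (F : Finset (Fin 4)) (p : Fin 4) (q : Q)
    {g : List Γ} (hg : g ≠ []) (ρ : List Γ) :
    M.advance F ⟨p, q, g ++ ρ⟩ = (M.advance F ⟨p, q, g⟩).map fun r =>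
      (r.1, ⟨r.2.pos, r.2.state, r.2.stack ++ ρ⟩) := by
  simp only [advance, act_append M q _ hg ρ, StepResult.map_map]

noncomputable instance : DecidableEq StackOp := Classical.decEq _

/-- The number of letters that may pop. -/
noncomputable def popBudget (M : IDPDA Letter Q Γ) (v : Fin 4 → ℕ) : ℕ :=
  ∑ n, if M.sig (blockLetter n) = StackOp.pop then v n else 0

lemma popBudget_consume_of_pop {M : IDPDA Letter Q Γ} {v : Fin 4 → ℕ} {n : Fin 4}
    (hv : v n ≠ 0) (hn : M.sig (blockLetter n) = StackOp.pop) :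
    M.popBudget (consume v (some n)) + 1 = M.popBudget v := by
  simp only [popBudget, consume, Option.elim]
  rw [← Finset.sum_erase_add _ _ (Finset.mem_univ n),
    ← Finset.sum_erase_add _ _ (Finset.mem_univ n)]
  have : ∀ i ∈ Finset.univ.erase n,
      (if M.sig (blockLetter i) = StackOp.pop then Function.update v n (v n - 1) i else 0) =
        if M.sig (blockLetter i) = StackOp.pop then v i else 0 := by
    intro i hi
    rw [Function.update_of_ne (Finset.ne_of_mem_erase hi)]
  rw [Finset.sum_congr rfl this]
  simp [hn]
  omega

lemma popBudget_consume_le {M : IDPDA Letter Q Γ} {v : Fin 4 → ℕ} {n : Fin 4} :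
    M.popBudget (consume v (some n)) ≤ M.popBudget v := by
  refine Finset.sum_le_sum fun i _ => ?_
  split_ifs
  · by_cases hi : i = n
    · subst hi; simp [consume]
    · simp [consume, Function.update_of_ne hi]
  · rfl

/-- Pushdown symbols that are deeper than the number of possible pops do not matter. -/
lemma acceptsIn_append_congr {M : IDPDA Letter Q Γ} {t : ℕ} {p : Fin 4} {q : Q} {g ρ : List Γ}
    (ρ' : List Γ) {v : Fin 4 → ℕ} (hg : M.popBudget v < g.length)
    (h : M.acceptsIn t ⟨p, q, g ++ ρ⟩ v) : M.acceptsIn t ⟨p, q, g ++ ρ'⟩ v := by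
  induction t generalizing p q g v with
  | zero => exact h
  | succ t ih =>
    have hne : g ≠ [] := by rintro rfl; simp at hg
    rw [acceptsIn, advance_append M _ _ _ hne] at h ⊢
    rcases ha : M.advance (nonemptyBlocks v) ⟨p, q, g⟩ with _ | _ | ⟨e, c'⟩ <;>
      simp only [ha, StepResult.map] at h ⊢
    -- The inequality persists: a popping letter lowers the budget by one and the height by at most
    -- one, any other step neither raises the budget nor lowers the height.
    refine ih ?_ h
    have hact := (advance_eq_go ha).2.2
    rcases e with _ | n
    · rw [advance_stack_none ha]
      exact hg
    · have hv := advance_mem ha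
      rw [mem_nonemptyBlocks] at hv
      by_cases hn : M.sig (blockLetter n) = StackOp.pop
      · have h1 := popBudget_consume_of_pop hv hn
        have h2 := le_act_length hact
        simp only at h2
        omega
      · have h1 := popBudget_consume_le (M := M) (v := v) (n := n)
        have h2 := le_act_length_of_ne_pop hn hact
        simp only at h2
        omega

lemma accepts_append_congr {M : IDPDA Letter Q Γ} {p : Fin 4} {q : Q} {g ρ ρ' : List Γ}
    {v : Fin 4 → ℕ} (hg : M.popBudget v < g.length) :
    M.accepts ⟨p, q, g ++ ρ⟩ v ↔ M.accepts ⟨p, q, g ++ ρ'⟩ v :=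
  ⟨fun ⟨t, h⟩ => ⟨t, acceptsIn_append_congr ρ' hg h⟩,
    fun ⟨t, h⟩ => ⟨t, acceptsIn_append_congr ρ hg h⟩⟩

lemma accepts_take_congr {M : IDPDA Letter Q Γ} {p : Fin 4} {q : Q} {γ γ' : List Γ}
    {v : Fin 4 → ℕ} {l : ℕ} (hl : M.popBudget v < l) (h : γ.take l = γ'.take l) :
    M.accepts ⟨p, q, γ⟩ v ↔ M.accepts ⟨p, q, γ'⟩ v := by
  by_cases hγ : l ≤ γ.length
  · rw [← List.take_append_drop l γ, ← List.take_append_drop l γ', ← h]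
    exact accepts_append_congr (by simpa [hγ] using hl)
  · have h1 : γ.take l = γ := List.take_of_length_le (by omega)
    have h2 : γ'.take l = γ' := by
      apply List.take_of_length_le
      have := congrArg List.length h
      simp only [List.length_take] at this
      omega
    rw [h1, h2] at h
    rw [h]

end IDPDA

/-! ### Configurations that decide the target -/

/-- The block lengths `(k, i, _, j)` for which `aᵏ bⁱ # bʲ` belongs to the witness language. -/
def InTarget (v : Fin 4 → ℕ) : Prop := 1 ≤ v 1 ∧ 1 ≤ v 3 ∧ (v 0 = v 1 ∨ v 0 = v 3)

/-- Used for test vectors with prescribed positive lengths on the blocks in `F`. -/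
lemma nonemptyBlocks_ite {F : Finset (Fin 4)} {u : Fin 4 → ℕ} (hu : ∀ i, u i ≠ 0) :
    nonemptyBlocks (fun i => if i ∈ F then u i else 0) = F := by
  ext i
  by_cases hi : i ∈ F <;> simp [hi, hu]

lemma nonemptyBlocks_add_single {w : Fin 4 → ℕ} {n : Fin 4} :
    nonemptyBlocks (w + Pi.single n 1) = insert n (nonemptyBlocks w) := by
  ext i
  by_cases hi : i = n
  · subst hi; simp
  · simp [hi]

lemma consume_add_single (w : Fin 4 → ℕ) (n : Fin 4) :
    consume (w + Pi.single n 1) (some n) = w := by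
  funext i
  by_cases hi : i = n
  · subst hi; simp [consume]
  · simp [consume, hi]

namespace IDPDA

variable {Q Γ : Type}

/-- From the configuration `c` with exactly the blocks in `F` nonempty, the automaton decides the
target for the block lengths shifted by `off`. -/
def Decides (M : IDPDA Letter Q Γ) (F : Finset (Fin 4)) (c : BlockConfig Q Γ)
    (off : Fin 4 → ℕ) : Prop :=
  ∀ w, nonemptyBlocks w = F → w 2 ≤ 1 → (M.accepts c w ↔ InTarget (off + w))

namespace Decides

variable {M : IDPDA Letter Q Γ} {F : Finset (Fin 4)} {c c' : BlockConfig Q Γ} {off : Fin 4 → ℕ}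

/-- The core of the pigeonhole arguments: one configuration cannot serve two offsets that some `w`
separates. -/
lemma congr (h : M.Decides F c off) {off' : Fin 4 → ℕ} (h' : M.Decides F c off') {w : Fin 4 → ℕ}
    (hw : nonemptyBlocks w = F) (hw2 : w 2 ≤ 1) : InTarget (off + w) ↔ InTarget (off' + w) := by
  rw [← h w hw hw2, ← h' w hw hw2]

lemma advance_none (h : M.Decides F c off)
    (ha : M.advance F c = StepResult.go (none, c')) : M.Decides F c' off := by
  intro w hw hw2
  subst hw
  rw [← h w rfl hw2, accepts_go ha]
  rfl

/-- The step is applied to lengths with one more letter in block `n`, so the block stays nonempty.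
For the separator this would violate `w 2 ≤ 1`. -/
lemma advance_some {n : Fin 4} (h : M.Decides F c off)
    (ha : M.advance F c = StepResult.go (some n, c')) (hn : n ≠ 2) :
    M.Decides F c' (off + Pi.single n 1) := by
  intro w hw hw2
  have hF : nonemptyBlocks (w + Pi.single n 1) = F := by
    rw [nonemptyBlocks_add_single, hw, Finset.insert_eq_of_mem (advance_mem ha)]
  have := h (w + Pi.single n 1) hF (by simpa [hn.symm] using hw2)
  rw [accepts_go (hF ▸ ha)] at this
  simp only [consume_add_single] at this
  rw [this, add_assoc, add_comm w]

/-- Here the letter read is the last one of its block. This is how the run common to all lengths is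
left. -/
lemma advance_exhaust {n : Fin 4} (h : M.Decides F c off)
    (ha : M.advance F c = StepResult.go (some n, c')) :
    M.Decides (F.erase n) c' (off + Pi.single n 1) := by
  intro w hw hw2
  have hF : nonemptyBlocks (w + Pi.single n 1) = F := by
    rw [nonemptyBlocks_add_single, hw, Finset.insert_erase (advance_mem ha)]
  have h2 : (w + Pi.single n 1 : Fin 4 → ℕ) 2 ≤ 1 := by
    by_cases hn : n = 2
    · subst hn
      have : 2 ∉ nonemptyBlocks w := by rw [hw]; simp
      simp only [mem_nonemptyBlocks, not_not] at this
      simp [this]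
    · simpa [Ne.symm hn] using hw2
  have := h (w + Pi.single n 1) hF h2
  rw [accepts_go (hF ▸ ha)] at this
  simp only [consume_add_single] at this
  rw [this, add_assoc, add_comm w]

lemma target_of_accept (h : M.Decides F c off) (ha : M.advance F c = StepResult.accept)
    {w : Fin 4 → ℕ} (hw : nonemptyBlocks w = F) (hw2 : w 2 ≤ 1) : InTarget (off + w) := by
  rw [← h w hw hw2, accepts_iff, hw, ha]
  trivial

lemma not_target_of_stuck (h : M.Decides F c off) (ha : M.advance F c = StepResult.stuck)
    {w : Fin 4 → ℕ} (hw : nonemptyBlocks w = F) (hw2 : w 2 ≤ 1) : ¬ InTarget (off + w) := by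
  rw [← h w hw hw2, accepts_iff, hw, ha]
  exact id

/-- Counting `a`s that have not yet been read excludes immediate acceptance. -/
lemma ne_accept (h : M.Decides F c off) (h0 : 0 ∈ F) : M.advance F c ≠ StepResult.accept := by
  intro ha
  -- Enough unread `a`s to outnumber both `b`-blocks.
  have := h.target_of_accept ha
    (w := fun i => if i ∈ F then (if i = 0 then off 1 + off 3 + 2 else 1) else 0)
    (nonemptyBlocks_ite fun i => by split_ifs <;> omega)
    (by simp only [Fin.reduceEq, if_false]; split_ifs <;> omega)
  simp only [InTarget, Pi.add_apply, h0, if_true, Fin.reduceEq, if_false] at this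
  split_ifs at this <;> omega

lemma ne_stuck (h : M.Decides F c off) (h0 : 0 ∈ F) (h1 : 1 ∈ F) (h3 : 3 ∈ F) :
    M.advance F c ≠ StepResult.stuck := by
  intro ha
  -- The `a`s and the first `b`-block both get total length `off 0 + off 1 + 1`.
  refine h.not_target_of_stuck ha
    (w := fun i => if i ∈ F then (if i = 0 then off 1 + 1 else if i = 1 then off 0 + 1 else 1)
      else 0)
    (nonemptyBlocks_ite fun i => by split_ifs <;> omega)
    (by simp only [Fin.reduceEq, if_false]; split_ifs <;> omega) ?_
  simp only [InTarget, Pi.add_apply, h0, h1, h3, if_true, Fin.reduceEq, if_false]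
  omega

/-- A run that deletes nothing is impossible. -/
lemma exists_event (h : M.Decides F c off) (h0 : 0 ∈ F) (h1 : 1 ∈ F) (h3 : 3 ∈ F)
    {run : ℕ → BlockConfig Q Γ} {e : ℕ → Option (Fin 4)} (hc : run 0 = c)
    (hrun : ∀ t, M.advance F (run t) = StepResult.go (e t, run (t + 1))) :
    ∃ t, e t ≠ none := by
  by_contra! hnone
  set w : Fin 4 → ℕ := fun i =>
    if i ∈ F then (if i = 0 then off 1 + 1 else if i = 1 then off 0 + 1 else 1) else 0 with hwdef
  have hw : nonemptyBlocks w = F := nonemptyBlocks_ite fun i => by split_ifs <;> omega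
  have hacc : M.accepts c w := by
    rw [h w hw (by simp only [hwdef, Fin.reduceEq, if_false]; split_ifs <;> omega)]
    simp only [hwdef, InTarget, Pi.add_apply, h0, h1, h3, if_true, Fin.reduceEq, if_false]
    omega
  obtain ⟨t, ht⟩ := hacc
  have key : ∀ t s, ¬ M.acceptsIn t (run s) w := by
    intro t
    induction t with
    | zero => exact fun s h => h
    | succ t ih =>
      intro s
      rw [acceptsIn, hw, hrun s, hnone s]
      exact ih (s + 1)
  exact key t 0 (hc ▸ ht)

/-- The situation after `t` steps of an infinite run that does not read the separator. -/
lemma run {run : ℕ → BlockConfig Q Γ} {e : ℕ → Option (Fin 4)} (h : M.Decides F (run 0) off)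
    (hrun : ∀ t, M.advance F (run t) = StepResult.go (e t, run (t + 1)))
    (he : ∀ t, e t ≠ some 2) (t : ℕ) :
    M.Decides F (run t) (off + fun i => Nat.count (fun s => e s = some i) t) := by
  induction t with
  | zero =>
    convert h using 1
    funext i
    simp
  | succ t ih =>
    have ha := hrun t
    rcases hn : e t with _ | n <;> rw [hn] at ha
    · convert ih.advance_none ha using 3
      simp [Nat.count_succ, hn]
    · convert ih.advance_some ha (by rintro rfl; exact he t hn) using 1
      funext i
      by_cases hi : i = n
      · subst hi; simp [Nat.count_succ, hn, add_assoc]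
      · simp [Nat.count_succ, hn, Ne.symm hi, hi]

/-- The situation after the last letter of a block has been read. -/
lemma run_exhaust {run : ℕ → BlockConfig Q Γ} {e : ℕ → Option (Fin 4)}
    (h : M.Decides F (run 0) off)
    (hrun : ∀ t, M.advance F (run t) = StepResult.go (e t, run (t + 1)))
    (he : ∀ t, e t ≠ some 2) {t : ℕ} {n : Fin 4} (hn : e t = some n) :
    M.Decides (F.erase n) (run (t + 1))
      (off + fun i => Nat.count (fun s => e s = some i) (t + 1)) := by
  convert (h.run hrun he t).advance_exhaust (hn ▸ hrun t) using 1
  funext i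
  by_cases hi : i = n
  · subst hi; simp [Nat.count_succ, hn, add_assoc]
  · simp [Nat.count_succ, hn, Ne.symm hi, hi]

end Decides

/-! ### Runs that read a single `b`-block -/

/-- If `b` pushes and the pushdown is not exhausted down to `ρ`, then the part `ρ` of the pushdown
does not matter. Hence a change of `ρ` that matters forces the automaton to read almost as many
`a`s as there are symbols above `ρ`. -/
lemma exists_low {M : IDPDA Letter Q Γ} (hb : M.sig Letter.b = StackOp.push) {n n' : Fin 4}
    (hn : n = 1 ∧ n' = 3 ∨ n = 3 ∧ n' = 1) {ρ ρ' : List Γ} {t : ℕ} {F : Finset (Fin 4)}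
    {p : Fin 4} {q : Q} {g : List Γ} {off w : Fin 4 → ℕ} (h0 : 0 ∈ F) (hn' : n' ∈ F) (hnF : n ∉ F)
    (hw : nonemptyBlocks w = F) (hw2 : w 2 ≤ 1) (hdec : M.Decides F ⟨p, q, g ++ ρ⟩ off)
    (hacc : M.acceptsIn t ⟨p, q, g ++ ρ⟩ w) (hrej : ¬ M.accepts ⟨p, q, g ++ ρ'⟩ w)
    (hg : 2 ≤ g.length) (hpot : w 0 + w 2 + 1 ≤ g.length + w n') :
    ∃ F' p' q' g' off', 0 ∈ F' ∧ n' ∈ F' ∧ n ∉ F' ∧ g'.length = 2 ∧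
      M.Decides F' ⟨p', q', g' ++ ρ⟩ off' ∧ off' n = off n ∧
      off' n' + off 0 + g.length ≤ off' 0 + off n' + 2 + w 2 := by
  have hbl : ∀ i, i = n ∨ i = n' → M.sig (blockLetter i) = StackOp.push := by
    rcases hn with ⟨rfl, rfl⟩ | ⟨rfl, rfl⟩ <;> rintro i (rfl | rfl) <;> exact hb
  have hn2 : n' ≠ 2 := by rcases hn with ⟨rfl, rfl⟩ | ⟨rfl, rfl⟩ <;> decide
  have hn0 : n' ≠ 0 := by rcases hn with ⟨rfl, rfl⟩ | ⟨rfl, rfl⟩ <;> decide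
  have hnn2 : n ≠ 2 := by rcases hn with ⟨rfl, rfl⟩ | ⟨rfl, rfl⟩ <;> decide
  have hnn0 : n ≠ 0 := by rcases hn with ⟨rfl, rfl⟩ | ⟨rfl, rfl⟩ <;> decide
  have hnn' : n ≠ n' := by rcases hn with ⟨rfl, rfl⟩ | ⟨rfl, rfl⟩ <;> decide
  have hall : ∀ i : Fin 4, i = 0 ∨ i = 2 ∨ i = n ∨ i = n' := by
    rcases hn with ⟨rfl, rfl⟩ | ⟨rfl, rfl⟩ <;> decide
  -- As `b` pushes, only `a`s and the separator can pop.
  have hbudget : ∀ v : Fin 4 → ℕ, M.popBudget v ≤ v 0 + v 2 := by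
    intro v
    have hb1 : M.sig (blockLetter 1) = StackOp.push := hb
    have hb3 : M.sig (blockLetter 3) = StackOp.push := hb
    simp only [popBudget, Fin.sum_univ_four, hb1, hb3, reduceCtorEq, if_false]
    split_ifs <;> omega
  induction t generalizing F p q g off w with
  | zero => exact hacc.elim
  | succ t ih =>
    -- Why the descent stops at two: from height at least three, reading the last `a` leaves at
    -- least two symbols above `ρ`, while only the separator could still pop.
    rcases hg.eq_or_lt with hg | hg
    · exact ⟨F, p, q, g, off, h0, hn', hnF, hg.symm, hdec, rfl, by omega⟩
    have hne : g ≠ [] := by rintro rfl; simp at hg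
    have happ := fun ρ => advance_append M F p q hne ρ
    rw [acceptsIn, hw, happ] at hacc
    rcases ha : M.advance F ⟨p, q, g⟩ with _ | _ | ⟨e, p', q', g'⟩
    · exact absurd (by rw [happ, ha]; rfl) (hdec.ne_accept h0)
    · rw [ha] at hacc
      exact hacc.elim
    simp only [ha, StepResult.map] at hacc happ
    rw [accepts_go (hw ▸ happ ρ')] at hrej
    have hact := (advance_eq_go ha).2.2
    simp only at hact hrej hacc
    have hle := le_act_length hact
    have hw0 : w 0 ≠ 0 := mem_nonemptyBlocks.1 (hw ▸ h0)
    have hwn' : w n' ≠ 0 := mem_nonemptyBlocks.1 (hw ▸ hn')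
    -- If the remaining pops cannot uncover the bottom part, exchanging it preserves acceptance,
    -- against `hrej`.
    have hstay : M.popBudget (consume w e) < g'.length → False := fun hlt =>
      hrej ⟨t, acceptsIn_append_congr ρ' hlt hacc⟩
    rcases e with _ | i
    · have hg' : g' = g := advance_stack_none ha
      subst hg'
      exact ih h0 hn' hnF hw hw2 (hdec.advance_none (happ ρ)) hacc hrej hg.le hpot
    have hiF := advance_mem ha
    have hnonempty : ∀ i, w i ≠ 1 → nonemptyBlocks (consume w (some i)) = F := by
      intro i hi
      rw [← hw]
      ext j
      by_cases hj : j = i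
      · subst hj; simp [consume]; omega
      · simp [consume, hj]
    rcases hall i with rfl | rfl | rfl | rfl
    · by_cases hw1 : w 0 = 1
      · refine (hstay ?_).elim
        have := hbudget (consume w (some 0))
        simp [consume, hw1] at this ⊢
        omega
      · obtain ⟨F', p₁, q₁, g₁, off', k1, k2, k3, k4, k5, k6, k7⟩ :=
          ih h0 hn' hnF (hnonempty 0 hw1) (by simpa [consume] using hw2)
          (hdec.advance_some (happ ρ) (by decide)) hacc hrej (by omega)
          (by simp [consume, hn0]; omega)
        refine ⟨F', p₁, q₁, g₁, off', k1, k2, k3, k4, k5, by simpa [hnn0] using k6, ?_⟩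
        simp [consume, hn0] at k7
        omega
    · have hw2' : w 2 = 1 := by
        have : w 2 ≠ 0 := mem_nonemptyBlocks.1 (hw ▸ hiF)
        omega
      obtain ⟨F', p₁, q₁, g₁, off', k1, k2, k3, k4, k5, k6, k7⟩ :=
          ih (F := F.erase 2) (w := consume w (some 2)) (by simp [h0]) (by simp [hn', hn2])
          (by simp [hnF])
          (by rw [← hw]
              ext j
              by_cases hj : j = 2
              · subst hj; simp [consume, hw2']
              · simp [consume, hj])
          (by simp [consume, hw2'])
          (hdec.advance_exhaust (happ ρ)) hacc hrej (by omega)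
          (by simp [consume, hn2, hw2']; omega)
      refine ⟨F', p₁, q₁, g₁, off', k1, k2, k3, k4, k5, by simpa [hnn2] using k6, ?_⟩
      simp [consume, hn2, hw2'] at k7
      omega
    · exact absurd hiF hnF
    · obtain ⟨z, hz⟩ := act_push_length (hbl i (Or.inr rfl)) hact
      have hlen : g'.length = g.length + 1 := by simp [hz]
      -- If this were the last letter of its block, `hpot` would bound the remaining pops by
      -- `g.length`, which is below the new height.
      by_cases hw1 : w i = 1
      · refine (hstay ?_).elim
        have := hbudget (consume w (some i))
        simp [consume, hn0.symm, hn2.symm] at this ⊢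
        omega
      · obtain ⟨F', p₁, q₁, g₁, off', k1, k2, k3, k4, k5, k6, k7⟩ :=
          ih h0 hn' hnF (hnonempty i hw1) (by simpa [consume, hn2.symm] using hw2)
          (hdec.advance_some (happ ρ) hn2) hacc hrej (by omega)
          (by simp [consume, hn0.symm, hn2.symm]; omega)
        refine ⟨F', p₁, q₁, g₁, off', k1, k2, k3, k4, k5, by simpa [hnn'] using k6, ?_⟩
        simp [consume, hn0.symm, hn2.symm] at k7
        omega

end IDPDA

lemma inTarget_iff {n n' : Fin 4} (hn : n = 1 ∧ n' = 3 ∨ n = 3 ∧ n' = 1) {v : Fin 4 → ℕ} :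
    InTarget v ↔ 1 ≤ v n ∧ 1 ≤ v n' ∧ (v 0 = v n ∨ v 0 = v n') := by
  rcases hn with ⟨rfl, rfl⟩ | ⟨rfl, rfl⟩
  · rfl
  · simp only [InTarget]
    tauto

lemma finite_stack_length_le {Q Γ : Type} [Finite Q] [Finite Γ] (l : ℕ) :
    Finite {c : BlockConfig Q Γ // c.stack.length ≤ l} := by
  have : Finite {γ : List Γ // γ.length ≤ l} := List.finite_length_le Γ l
  refine Finite.of_injective
    (fun c => ((c.1.pos, c.1.state, ⟨c.1.stack, c.2⟩) : Fin 4 × Q × {γ : List Γ // γ.length ≤ l}))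
    fun c c' h => ?_
  simp only [Prod.mk.injEq, Subtype.mk.injEq] at h
  exact Subtype.ext (BlockConfig.ext h.1 h.2.1 h.2.2)

namespace IDPDA

variable {Q Γ : Type} {M : IDPDA Letter Q Γ}

/-- The length of a completely read `b`-block cannot be stored in boundedly many symbols. -/
lemma not_decides_bounded [Finite Q] [Finite Γ] {n n' : Fin 4}
    (hn : n = 1 ∧ n' = 3 ∨ n = 3 ∧ n' = 1) {F : Finset (Fin 4)} (h0 : 0 ∈ F) (hn' : n' ∈ F)
    (hnF : n ∉ F) {off : Fin 4 → ℕ} {m₀ l : ℕ}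
    (h : ∀ m, m₀ ≤ m → ∃ c : BlockConfig Q Γ, c.stack.length ≤ l ∧
      M.Decides F c (off + Pi.single n m)) : False := by
  have hn2 : n' ≠ 2 := by rcases hn with ⟨rfl, rfl⟩ | ⟨rfl, rfl⟩ <;> decide
  have hn0 : n' ≠ 0 := by rcases hn with ⟨rfl, rfl⟩ | ⟨rfl, rfl⟩ <;> decide
  have hnn0 : n ≠ 0 := by rcases hn with ⟨rfl, rfl⟩ | ⟨rfl, rfl⟩ <;> decide
  have hnn' : n ≠ n' := by rcases hn with ⟨rfl, rfl⟩ | ⟨rfl, rfl⟩ <;> decide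
  have := finite_stack_length_le (Q := Q) (Γ := Γ) l
  choose c hc hdec using fun m => h (m₀ + off 0 + 1 + m) (by omega)
  obtain ⟨m, m', hne, heq⟩ := Finite.exists_ne_map_eq_of_infinite
    (fun m => (⟨c m, hc m⟩ : {c : BlockConfig Q Γ // c.stack.length ≤ l}))
  simp only [Subtype.mk.injEq] at heq
  have h' := hdec m'
  rw [← heq] at h'
  -- For index `m` the `a`s match block `n` exactly, for `m'` they do not; block `n'` is too long to
  -- match.
  have key := (hdec m).congr h'
    (w := fun i => if i ∈ F then (if i = 0 then off n + (m₀ + 1 + m) else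
      if i = n' then off 0 + off n + (m₀ + 1 + m) + 1 else 1) else 0)
    (nonemptyBlocks_ite fun i => by split_ifs <;> omega)
    (by simp only [Fin.reduceEq, if_false, hn2.symm]; split_ifs <;> omega)
  simp only [inTarget_iff hn, Pi.add_apply, h0, hn', hnF, if_true, if_false, hn0, hnn0.symm,
    hnn'.symm, Pi.single_eq_same, Pi.single_eq_of_ne, ne_eq, not_false_eq_true] at key
  omega

/-- The length of a completely read `b`-block cannot be stored in the pushdown by pushing `b`s. -/
lemma not_decides_push [Finite Q] [Finite Γ] (hb : M.sig Letter.b = StackOp.push) {n n' : Fin 4}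
    (hn : n = 1 ∧ n' = 3 ∨ n = 3 ∧ n' = 1) {F : Finset (Fin 4)} (h0 : 0 ∈ F) (hn' : n' ∈ F)
    (hnF : n ∉ F) {off : Fin 4 → ℕ} {m₀ Δ : ℕ} (hΔ : 1 ≤ Δ) {ρ ρ' : List Γ}
    (h : ∀ m, m₀ ≤ m → ∃ p q g, m ≤ g.length + m₀ ∧
      M.Decides F ⟨p, q, g ++ ρ⟩ (off + Pi.single n m) ∧
      M.Decides F ⟨p, q, g ++ ρ'⟩ (off + Pi.single n (m + Δ))) : False := by
  have hn2 : n' ≠ 2 := by rcases hn with ⟨rfl, rfl⟩ | ⟨rfl, rfl⟩ <;> decide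
  have hn0 : n' ≠ 0 := by rcases hn with ⟨rfl, rfl⟩ | ⟨rfl, rfl⟩ <;> decide
  have hnn0 : n ≠ 0 := by rcases hn with ⟨rfl, rfl⟩ | ⟨rfl, rfl⟩ <;> decide
  have hnn' : n ≠ n' := by rcases hn with ⟨rfl, rfl⟩ | ⟨rfl, rfl⟩ <;> decide
  -- Bounded height, but the excess of `a`s over letters of block `n'` read so far grows with `m`.
  have hlow : ∀ m, ∃ (F' : Finset (Fin 4)) (c : {c : BlockConfig Q Γ // c.stack.length ≤ 2 + ρ.length})
      (off' : Fin 4 → ℕ), 0 ∈ F' ∧ n' ∈ F' ∧ n ∉ F' ∧ M.Decides F' c.1 off' ∧ 1 ≤ off' n ∧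
      off' n' + off 0 + m ≤ off' 0 + off n' + 3 := by
    intro m
    obtain ⟨p, q, g, hlen, hd, hd'⟩ := h (m₀ + off 0 + 2 + m) (by omega)
    -- With `ρ` the `a`s match block `n`; with `ρ'` that block is longer by `Δ`. Block `n'` is too
    -- long to match in both cases, which also gives the inequality `hpot` of `exists_low`.
    set w : Fin 4 → ℕ := fun i => if i ∈ F then (if i = 0 then off n + (m₀ + 2 + m) else
      if i = n' then off 0 + off n + (m₀ + 2 + m) + 2 else 1) else 0 with hwdef
    have hw : nonemptyBlocks w = F := nonemptyBlocks_ite fun i => by split_ifs <;> omega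
    have hw2 : w 2 ≤ 1 := by
      simp only [hwdef, Fin.reduceEq, if_false, hn2.symm]; split_ifs <;> omega
    have hw0 : w 0 = off n + (m₀ + 2 + m) := by simp [hwdef, h0]
    have hwn : w n = 0 := by simp [hwdef, hnF]
    have hwn' : w n' = off 0 + off n + (m₀ + 2 + m) + 2 := by simp [hwdef, hn', hn0]
    have hacc : M.accepts ⟨p, q, g ++ ρ⟩ w := by
      rw [hd w hw hw2, inTarget_iff hn]
      simp only [Pi.add_apply, hw0, hwn, hwn', Pi.single_eq_same, Pi.single_eq_of_ne, ne_eq,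
        hnn0.symm, hnn'.symm, not_false_eq_true]
      omega
    have hrej : ¬ M.accepts ⟨p, q, g ++ ρ'⟩ w := by
      rw [hd' w hw hw2, inTarget_iff hn]
      simp only [Pi.add_apply, hw0, hwn, hwn', Pi.single_eq_same, Pi.single_eq_of_ne, ne_eq,
        hnn0.symm, hnn'.symm, not_false_eq_true]
      omega
    obtain ⟨t, hacc⟩ := hacc
    obtain ⟨F', p', q', g', off', k1, k2, k3, k4, k5, k6, k7⟩ :=
      exists_low hb hn h0 hn' hnF hw hw2 hd hacc hrej (by omega) (by omega)
    refine ⟨F', ⟨⟨p', q', g' ++ ρ⟩, by simp [k4]⟩, off', k1, k2, k3, k5, ?_, ?_⟩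
    · rw [k6]
      simp only [Pi.add_apply, Pi.single_eq_same]
      omega
    · simp only [Pi.add_apply, Pi.single_eq_of_ne, ne_eq, hnn0.symm, hnn'.symm,
        not_false_eq_true] at k7
      omega
  choose F' c off' k0 kn' kn kdec kpos kle using hlow
  have := finite_stack_length_le (Q := Q) (Γ := Γ) (2 + ρ.length)
  obtain ⟨y, hy⟩ := Finite.exists_infinite_fiber fun m => (F' m, c m)
  have hy' := Set.infinite_coe_iff.1 hy
  obtain ⟨m, hm⟩ := hy'.nonempty
  -- Far enough for the excess at `m'` to be larger than the one at `m`.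
  obtain ⟨m', hm', hlt⟩ := hy'.exists_gt (off' m 0 + off n' + 3)
  have heq : (F' m, c m) = (F' m', c m') := hm.trans hm'.symm
  obtain ⟨hF, hc⟩ := Prod.mk.inj heq
  have hd' := kdec m'
  rw [← hF, ← hc] at hd'
  -- For `m` the `a`s match block `n'`; for `m'` they outnumber both blocks.
  have key := (kdec m).congr hd'
    (w := fun i => if i ∈ F' m then (if i = 0 then off' m n' + off' m n + off' m' n + 1 else
      if i = n' then off' m 0 + off' m n + off' m' n + 1 else 1) else 0)
    (nonemptyBlocks_ite fun i => by split_ifs <;> omega)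
    (by simp only [Fin.reduceEq, if_false, hn2.symm]; split_ifs <;> omega)
  simp only [inTarget_iff hn, Pi.add_apply, k0, kn', kn, if_true, if_false, hn0] at key
  have h1 := kpos m
  have h2 := kpos m'
  have h3 := kle m'
  omega

/-- It is impossible that, as long as no block is exhausted, only letters of one of the `b`-blocks
are read. -/
lemma Decides.not_read_forever [Finite Q] [Finite Γ] {n n' : Fin 4}
    (hn : n = 1 ∧ n' = 3 ∨ n = 3 ∧ n' = 1) {F : Finset (Fin 4)} (h0 : 0 ∈ F) (hn' : n' ∈ F)
    {off : Fin 4 → ℕ} {run : ℕ → BlockConfig Q Γ} {e : ℕ → Option (Fin 4)}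
    (hrun : ∀ t, M.advance F (run t) = StepResult.go (e t, run (t + 1)))
    (he : ∀ t, e t = none ∨ e t = some n) (hinf : ∀ t, ∃ u, t ≤ u ∧ e u = some n)
    (hdec : M.Decides F (run 0) off) : False := by
  have hnn0 : n ≠ 0 := by rcases hn with ⟨rfl, rfl⟩ | ⟨rfl, rfl⟩ <;> decide
  have hn0 : n' ≠ 0 := by rcases hn with ⟨rfl, rfl⟩ | ⟨rfl, rfl⟩ <;> decide
  have hnn' : n ≠ n' := by rcases hn with ⟨rfl, rfl⟩ | ⟨rfl, rfl⟩ <;> decide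
  have hnn2 : n ≠ 2 := by rcases hn with ⟨rfl, rfl⟩ | ⟨rfl, rfl⟩ <;> decide
  have hsig : M.sig (blockLetter n) = M.sig Letter.b := by
    rcases hn with ⟨rfl, rfl⟩ | ⟨rfl, rfl⟩ <;> rfl
  have he2 : ∀ t, e t ≠ some 2 := by
    intro t h
    rcases he t with h' | h' <;> rw [h'] at h
    · simp at h
    · exact hnn2 (by simpa using h)
  set cnt : ℕ → ℕ := fun t => Nat.count (fun s => e s = some n) t with hcnt
  have hexh : ∀ t, e t = some n →
      M.Decides (F.erase n) (run (t + 1)) (off + Pi.single n (cnt t + 1)) := by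
    intro t ht
    convert hdec.run_exhaust hrun he2 ht using 2
    funext i
    by_cases hi : i = n
    · subst hi; simp [Nat.count_succ, ht, hcnt]
    · rw [Pi.single_eq_of_ne hi, eq_comm, Nat.count_iff_forall_not]
      intro k _ hk
      rcases he k with h' | h' <;> rw [h'] at hk
      · simp at hk
      · exact hi (by simpa using hk.symm)
  have hset : {s | e s = some n}.Infinite :=
    Nat.frequently_atTop_iff_infinite.1 (Filter.frequently_atTop.2 hinf)
  have h0' : (0 : Fin 4) ∈ F.erase n := Finset.mem_erase.2 ⟨hnn0.symm, h0⟩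
  have hn'' : n' ∈ F.erase n := Finset.mem_erase.2 ⟨hnn'.symm, hn'⟩
  by_cases hpush : M.sig Letter.b = StackOp.push
  · have hstep : ∀ t, e t = some n → ∃ z, (run (t + 1)).stack = z :: (run t).stack := by
      intro t ht
      have := (advance_eq_go (hrun t)).2.2
      rw [ht] at this
      exact act_push_length (hsig.trans hpush) this
    obtain ⟨t₀, -, ht₀⟩ := hinf 0
    have hne : ∀ t, t₀ + 1 ≤ t → (run t).stack ≠ [] := by
      intro t ht
      induction t, ht using Nat.le_induction with
      | base =>
        obtain ⟨z, hz⟩ := hstep t₀ ht₀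
        simp [hz]
      | succ t _ ih =>
        rcases he t with h | h
        · rw [advance_stack_none (h ▸ hrun t)]
          exact ih
        · obtain ⟨z, hz⟩ := hstep t h
          simp [hz]
    obtain ⟨y, hy⟩ := Finite.exists_infinite_fiber fun t =>
      ((run (t₀ + 1 + t)).pos, (run (t₀ + 1 + t)).state, (run (t₀ + 1 + t)).stack.head?)
    have hy' := Set.infinite_coe_iff.1 hy
    obtain ⟨s₁, hs₁⟩ := hy'.nonempty
    obtain ⟨u, hu, heu⟩ := hinf (t₀ + 1 + s₁)
    -- Beyond `u`, so that at least one letter is read in between and `Δ` becomes positive.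
    obtain ⟨s₂, hs₂, hlt⟩ := hy'.exists_gt u
    have heq := hs₁.trans hs₂.symm
    generalize hs : t₀ + 1 + s₁ = s at *
    generalize hs' : t₀ + 1 + s₂ = s' at *
    simp only [hs, hs', Prod.mk.injEq] at heq
    obtain ⟨hpos, hstate, hhead⟩ := heq
    obtain ⟨z, ρ, hρ⟩ := List.exists_cons_of_ne_nil (hne s (by omega))
    obtain ⟨z', ρ', hρ'⟩ := List.exists_cons_of_ne_nil (hne s' (by omega))
    rw [hρ, hρ'] at hhead
    obtain rfl : z = z' := by simpa using hhead
    -- Nothing is popped any more, so `ρ` and `ρ'` stay covered and the runs from `s` and `s'` agree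
    -- above them.
    have hsim : ∀ r, ∃ p q g, run (s + r) = ⟨p, q, g ++ ρ⟩ ∧ run (s' + r) = ⟨p, q, g ++ ρ'⟩ ∧
        g ≠ [] ∧ g.length + cnt s = cnt (s + r) + 1 ∧
        cnt (s' + r) + cnt s = cnt (s + r) + cnt s' := by
      intro r
      induction r with
      | zero =>
        refine ⟨(run s).pos, (run s).state, [z], BlockConfig.ext rfl rfl hρ,
          BlockConfig.ext hpos.symm hstate.symm hρ', by simp, by simp [add_comm], ?_⟩
        simp only [add_zero]
        omega
      | succ r ih =>
        obtain ⟨p, q, g, h1, h2, h3, h4, h5⟩ := ih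
        have ha := hrun (s + r)
        have ha' := hrun (s' + r)
        rw [h1, advance_append M F p q h3] at ha
        rw [h2, advance_append M F p q h3] at ha'
        rcases hadv : M.advance F ⟨p, q, g⟩ with _ | _ | ⟨e', p', q', g'⟩ <;>
          simp only [hadv, StepResult.map, StepResult.go.injEq, Prod.mk.injEq, reduceCtorEq] at ha ha'
        refine ⟨p', q', g', ha.2.symm, ha'.2.symm, ?_, ?_⟩
        · rcases he (s + r) with h | h
          · rw [ha.1, h] at hadv
            have := advance_stack_none hadv
            simp only at this
            rwa [this]
          · have hact := (advance_eq_go hadv).2.2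
            rw [ha.1, h] at hact
            obtain ⟨z, hz⟩ := act_push_length (hsig.trans hpush) hact
            simp only at hz
            simp [hz]
        · rw [← add_assoc, ← add_assoc]
          simp only [hcnt, Nat.count_succ] at h4 h5 ⊢
          rw [← ha.1, ← ha'.1]
          rcases he (s + r) with h | h
          · rw [ha.1, h] at hadv
            have := advance_stack_none hadv
            simp only at this
            simp only [ha.1, h, this, reduceCtorEq, if_false]
            omega
          · have hact := (advance_eq_go hadv).2.2
            rw [ha.1, h] at hact
            obtain ⟨z, hz⟩ := act_push_length (hsig.trans hpush) hact
            simp only at hz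
            simp only [ha.1, h, hz, if_true, List.length_cons]
            omega
    have hΔ : cnt s + 1 ≤ cnt s' := by
      have h1 : cnt s ≤ cnt u := Nat.count_monotone _ hu
      have h2 : cnt (u + 1) ≤ cnt s' := Nat.count_monotone _ (by omega)
      have h3 : cnt (u + 1) = cnt u + 1 := by simp [hcnt, Nat.count_succ, heu]
      omega
    refine not_decides_push (m₀ := cnt s + 1) (Δ := cnt s' - cnt s) (ρ := ρ) (ρ' := ρ') (off := off)
      hpush hn h0' hn'' (by simp) (by omega) fun m hm => ?_
    -- The time at which the `m`-th letter of block `n` is read; `Nat.nth` counts from zero.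
    set t := Nat.nth (fun s => e s = some n) (m - 1) with ht
    have het : e t = some n := Nat.nth_mem_of_infinite hset _
    have hct : cnt t = m - 1 := Nat.count_nth_of_infinite hset _
    have hst : s ≤ t := by
      by_contra! hlt
      have h1 : cnt (t + 1) ≤ cnt s := Nat.count_monotone _ hlt
      have h2 : cnt (t + 1) = cnt t + 1 := by simp [hcnt, Nat.count_succ, het]
      omega
    clear_value t
    obtain ⟨r, rfl⟩ := Nat.exists_eq_add_of_le hst
    obtain ⟨p, q, g, h1, h2, h3, h4, h5⟩ := hsim r
    have ha := hrun (s + r)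
    have ha' := hrun (s' + r)
    rw [h1, advance_append M F p q h3] at ha
    rw [h2, advance_append M F p q h3] at ha'
    rcases hadv : M.advance F ⟨p, q, g⟩ with _ | _ | ⟨e', p', q', g'⟩ <;>
      simp only [hadv, StepResult.map, StepResult.go.injEq, Prod.mk.injEq, reduceCtorEq] at ha ha'
    have het' : e (s' + r) = some n := by rw [← ha'.1, ha.1, het]
    have hact := (advance_eq_go hadv).2.2
    rw [ha.1, het] at hact
    obtain ⟨z, hz⟩ := act_push_length (hsig.trans hpush) hact
    simp only at hz
    refine ⟨p', q', g', ?_, ?_, ?_⟩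
    · rw [hz, List.length_cons]
      omega
    · rw [ha.2]
      convert hexh _ het using 3
      omega
    · rw [ha'.2]
      convert hexh _ het' using 3
      omega
  · have hle : ∀ t, (run t).stack.length ≤ (run 0).stack.length := by
      intro t
      induction t with
      | zero => rfl
      | succ t ih =>
        refine le_trans ?_ ih
        rcases he t with h | h
        · rw [advance_stack_none (h ▸ hrun t)]
        · have := (advance_eq_go (hrun t)).2.2
          rw [h] at this
          exact act_length_le_of_ne_push (by rwa [hsig]) this
    refine not_decides_bounded (M := M) (m₀ := 1) (l := (run 0).stack.length) (off := off) hn h0' hn''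
      (by simp) fun m hm => ?_
    refine ⟨run (Nat.nth (fun s => e s = some n) (m - 1) + 1), hle _, ?_⟩
    convert hexh _ (Nat.nth_mem_of_infinite hset (m - 1)) using 3
    have : cnt (Nat.nth (fun s => e s = some n) (m - 1)) = m - 1 :=
      Nat.count_nth_of_infinite hset _
    omega

end IDPDA

/-! ### Runs that read infinitely many `a`s -/

namespace IDPDA

variable {Q Γ : Type} {M : IDPDA Letter Q Γ}

namespace Decides

variable {F : Finset (Fin 4)} {c : BlockConfig Q Γ} {off off' : Fin 4 → ℕ}

/-- Both `b`-blocks may still turn out longer than the number of `a`s. -/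
lemma ne_accept_of_notMem (h : M.Decides F c off) (h0 : 0 ∉ F) (h1 : 1 ∈ F) (h3 : 3 ∈ F) :
    M.advance F c ≠ StepResult.accept := by
  intro ha
  have := h.target_of_accept ha
    (w := fun i => if i ∈ F then (if i = 2 then 1 else off 0 + 1) else 0)
    (nonemptyBlocks_ite fun i => by split_ifs <;> omega)
    (by simp only [if_true]; split_ifs <;> omega)
  simp only [InTarget, Pi.add_apply, h0, h1, h3, if_true, Fin.reduceEq, if_false] at this
  omega

/-- A configuration in which all `a`s have been read has to determine their number. -/
lemma zero_eq_of_notMem (h : M.Decides F c off) (h' : M.Decides F c off') (h0 : 0 ∉ F)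
    (h1 : 1 ∈ F) (h3 : 3 ∈ F) (hoff : off 3 = 0) (hoff' : off' 3 = 0) (hpos : 1 ≤ off 0) :
    off 0 = off' 0 := by
  -- The second `b`-block matches the first offset, and the first `b`-block is too long for either.
  have key := h.congr h'
    (w := fun i => if i ∈ F then (if i = 1 then off 0 + off' 0 + 1 else if i = 3 then off 0 else 1)
      else 0)
    (nonemptyBlocks_ite fun i => by split_ifs <;> omega)
    (by simp only [Fin.reduceEq, if_false]; split_ifs <;> omega)
  simp only [InTarget, Pi.add_apply, h0, h1, h3, if_true, Fin.reduceEq, if_false] at key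
  omega

end Decides

/-- By `zero_eq_of_notMem` the number `k` is a function of the configuration. -/
lemma finite_zero_of_decides [Finite Q] [Finite Γ] (M : IDPDA Letter Q Γ) {F : Finset (Fin 4)}
    (h0 : 0 ∉ F) (h1 : 1 ∈ F) (h3 : 3 ∈ F) (l : ℕ) :
    {k | 1 ≤ k ∧ ∃ (c : BlockConfig Q Γ) (off : Fin 4 → ℕ), c.stack.length ≤ l ∧ off 0 = k ∧
      off 3 = 0 ∧ M.Decides F c off}.Finite := by
  have := finite_stack_length_le (Q := Q) (Γ := Γ) l
  refine Set.finite_coe_iff.1 ?_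
  choose c off hc h using fun k : {k | 1 ≤ k ∧ ∃ (c : BlockConfig Q Γ) (off : Fin 4 → ℕ),
    c.stack.length ≤ l ∧ off 0 = k ∧ off 3 = 0 ∧ M.Decides F c off} => k.2.2
  refine Finite.of_injective
    (fun k => (⟨c k, hc k⟩ : {c : BlockConfig Q Γ // c.stack.length ≤ l})) fun k k' heq => ?_
  simp only [Subtype.mk.injEq] at heq
  have hk := h k
  have hk' := h k'
  rw [← heq] at hk'
  have hpos := k.2.1
  have := hk.2.2.zero_eq_of_notMem hk'.2.2 h0 h1 h3 hk.2.1 hk'.2.1 (by omega)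
  exact Subtype.ext (by omega)

/-- If `b` pops, then after all `a`s have been read, either the pushdown can be emptied with the
help of the first `b`-block, or the separator is read. -/
lemma exists_empty_or_separator (hb : M.sig Letter.b = StackOp.pop) {t B : ℕ}
    {c : BlockConfig Q Γ} {off w : Fin 4 → ℕ} (hdec : M.Decides {1, 2, 3} c off)
    (hacc : M.acceptsIn t c w) (hw : nonemptyBlocks w = {1, 2, 3}) (hpos : c.pos ≤ 1)
    (hoff : off 3 = 0) (hlen : c.stack.length < w 1) (hB : c.stack.length + off 1 ≤ B) :
    (∃ (c' : BlockConfig Q Γ) (off' : Fin 4 → ℕ), c'.stack = [] ∧ off' 0 = off 0 ∧ off' 3 = 0 ∧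
      M.Decides {1, 2, 3} c' off') ∨
    ∃ (c' : BlockConfig Q Γ) (off' : Fin 4 → ℕ), c'.pos = 2 ∧ off' 0 = off 0 ∧ off' 3 = 0 ∧
      c'.stack.length + off' 1 ≤ B + 1 ∧ M.Decides {1, 3} c' off' := by
  induction t generalizing c off w with
  | zero => exact hacc.elim
  | succ t ih =>
    by_cases hne : c.stack = []
    · exact Or.inl ⟨c, off, hne, rfl, hoff, hdec⟩
    have hlen0 := List.length_pos_iff.2 hne
    rw [acceptsIn, hw] at hacc
    rcases ha : M.advance {1, 2, 3} c with _ | _ | ⟨e, c'⟩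
    · exact absurd ha (hdec.ne_accept_of_notMem (by decide) (by decide) (by decide))
    · rw [ha] at hacc
      exact hacc.elim
    simp only [ha] at hacc
    have hact := (advance_eq_go ha).2.2
    rcases e with _ | i
    · have hs := advance_stack_none ha
      exact ih (hdec.advance_none ha) hacc hw (by rw [advance_pos ha]; decide) hoff
        (by rwa [hs]) (by rwa [hs])
    have hi := advance_mem ha
    simp only [Finset.mem_insert, Finset.mem_singleton] at hi
    rcases hi with rfl | rfl | rfl
    -- The height drops by one while `off 1` grows by one, so `B` still bounds their sum; `hlen`
    -- keeps the block from being exhausted.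
    · have hs : c'.stack.length = c.stack.length - 1 := by
        rw [act_pop hb hact, List.length_tail]
      have := ih (hdec.advance_some ha (by decide)) hacc
        (by
          rw [← hw]
          ext j
          by_cases hj : j = 1
          · subst hj; simp [consume]; omega
          · simp [consume, hj])
        (by rw [advance_pos ha]; decide) (by simpa using hoff)
        (by simp [consume]; omega) (by simp; omega)
      simpa using this
    · have hd := hdec.advance_exhaust ha
      have hF : ({1, 2, 3} : Finset (Fin 4)).erase 2 = {1, 3} := by decide
      rw [hF] at hd
      -- The separator may push, whence `B + 1`.
      have hle := act_length_le hact
      refine Or.inr ⟨c', _, advance_pos ha, ?_, ?_, ?_, hd⟩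
      · simp
      · simpa using hoff
      · simp
        omega
    · exact absurd ha (advance_ne_three (by decide) hpos)

/-- If only the two `b`-blocks are left, then the automaton must not return to the left end before
the second one is exhausted. -/
lemma Deterministic.not_decides_left (hM : M.Deterministic) {c : BlockConfig Q Γ}
    {off : Fin 4 → ℕ} (hdec : M.Decides {1, 3} c off) (hc : c.pos = 0) (hoff : off 1 < off 0) :
    False := by
  obtain ⟨p, q, γ⟩ := c
  obtain rfl : p = 0 := hc
  -- Two vectors with the same total of `b`s; only in the first one does a block match the `a`s.
  have h1 := hdec ![0, off 0 - off 1, 0, off 0 + 2]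
    (by ext i; fin_cases i <;> simp; omega) (by simp)
  have h2 := hdec ![0, off 0 - off 1 + 1, 0, off 0 + 1]
    (by ext i; fin_cases i <;> simp) (by simp)
  rw [hM.accepts_merge (v' := ![0, off 0 - off 1 + 1, 0, off 0 + 1]) (by simp) (by simp) (by simp)
    (by simp; omega), h2] at h1
  simp [InTarget] at h1
  omega

/-- The merging argument of `not_decides_left`. Unread `a`s can be chosen to match, so no condition
on `off` is needed. -/
lemma Deterministic.not_decides_left_of_zero_mem (hM : M.Deterministic) {c : BlockConfig Q Γ}
    {off : Fin 4 → ℕ} (hdec : M.Decides {0, 1, 3} c off) (hc : c.pos = 0) : False := by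
  obtain ⟨p, q, γ⟩ := c
  obtain rfl : p = 0 := hc
  have h1 := hdec ![off 1 + 1, off 0 + 1, 0, off 0 + off 1 + 3]
    (by ext i; fin_cases i <;> simp) (by simp)
  have h2 := hdec ![off 1 + 1, off 0 + 2, 0, off 0 + off 1 + 2]
    (by ext i; fin_cases i <;> simp) (by simp)
  rw [hM.accepts_merge (v' := ![off 1 + 1, off 0 + 2, 0, off 0 + off 1 + 2]) (by simp) (by simp)
    (by simp) (by simp; omega), h2] at h1
  simp [InTarget] at h1
  omega

/-- The head is past the first block and must not return, so only the second block is read. Each of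
its letters pops, and there are more of them than pushdown symbols. -/
lemma Deterministic.exists_empty (hM : M.Deterministic) (hb : M.sig Letter.b = StackOp.pop)
    {t : ℕ} {c : BlockConfig Q Γ} {off w : Fin 4 → ℕ} (hdec : M.Decides {1, 3} c off)
    (hacc : M.acceptsIn t c w) (hw : nonemptyBlocks w = {1, 3}) (hpos : 2 ≤ c.pos)
    (hoff : off 1 < off 0) (hlen : c.stack.length < w 3) :
    ∃ (c' : BlockConfig Q Γ) (off' : Fin 4 → ℕ), c'.stack = [] ∧ off' 0 = off 0 ∧
      off' 1 = off 1 ∧ M.Decides {1, 3} c' off' := by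
  induction t generalizing c off w with
  | zero => exact hacc.elim
  | succ t ih =>
    by_cases hne : c.stack = []
    · exact ⟨c, off, hne, rfl, rfl, hdec⟩
    have hlen0 := List.length_pos_iff.2 hne
    rw [acceptsIn, hw] at hacc
    rcases ha : M.advance {1, 3} c with _ | _ | ⟨e, c'⟩
    · exact absurd ha (hdec.ne_accept_of_notMem (by decide) (by decide) (by decide))
    · rw [ha] at hacc
      exact hacc.elim
    simp only [ha] at hacc
    have hact := (advance_eq_go ha).2.2
    rcases e with _ | i
    · exact (hM.not_decides_left (hdec.advance_none ha) (advance_pos ha) hoff).elim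
    have hi := advance_mem ha
    simp only [Finset.mem_insert, Finset.mem_singleton] at hi
    rcases hi with rfl | rfl
    · exact absurd (hpos.trans (advance_pos_le ha)) (by decide)
    · have hs : c'.stack.length = c.stack.length - 1 := by
        rw [act_pop hb hact, List.length_tail]
      have := ih (hdec.advance_some ha (by decide)) hacc
        (by
          rw [← hw]
          ext j
          by_cases hj : j = 3
          · subst hj; simp [consume]; omega
          · simp [consume, hj])
        (by rw [advance_pos ha]; decide) (by simpa using hoff)
        (by simp [consume]; omega)
      simpa using this

/-- If `b` pops, the number of `a`s cannot be stored in a pushdown whose height is bounded by the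
difference of the numbers of `a`s and `b`s read. -/
lemma Deterministic.not_decides_pop [Finite Q] [Finite Γ] (hM : M.Deterministic)
    (hb : M.sig Letter.b = StackOp.pop) {k₀ C : ℕ}
    (h : ∀ k, k₀ ≤ k → ∃ (c : BlockConfig Q Γ) (off : Fin 4 → ℕ), c.pos = 0 ∧ off 0 = k ∧
      off 3 = 0 ∧ c.stack.length + off 1 ≤ k + C ∧ M.Decides {1, 2, 3} c off) : False := by
  -- Above `b₁` the number of `a`s cannot be determined with an empty pushdown, so the separator has
  -- to be read first.
  obtain ⟨b₁, hb₁⟩ := (M.finite_zero_of_decides (F := {1, 2, 3}) (by decide) (by decide)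
    (by decide) 0).bddAbove
  have hsep : ∀ k, k₀ + b₁ + 1 ≤ k → ∃ (c : BlockConfig Q Γ) (off : Fin 4 → ℕ), c.pos = 2 ∧
      off 0 = k ∧ off 3 = 0 ∧ c.stack.length + off 1 ≤ k + C + 1 ∧ M.Decides {1, 3} c off := by
    intro k hk
    obtain ⟨c, off, h1, h2, h3, h4, h5⟩ := h k (by omega)
    have hw : nonemptyBlocks ![0, c.stack.length + 1, 1, k] = {1, 2, 3} := by
      ext i; fin_cases i <;> simp; omega
    obtain ⟨t, ht⟩ := (h5 ![0, c.stack.length + 1, 1, k] hw (by simp)).2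
      (by simp [InTarget]; omega)
    rcases exists_empty_or_separator hb h5 ht hw (by rw [h1]; decide) h3 (by simp) h4 with
      ⟨c', off', k1, k2, k3, k4⟩ | ⟨c', off', k1, k2, k3, k4, k5⟩
    · have := hb₁ ⟨(by omega : 1 ≤ k), c', off', by simp [k1], by omega, k3, k4⟩
      omega
    · exact ⟨c', off', k1, by omega, k3, k4, k5⟩
  have hempty : ∀ j : ℕ, ∃ (c : {c : BlockConfig Q Γ // c.stack.length ≤ 0}) (off : Fin 4 → ℕ),
      off 1 + j + 1 ≤ off 0 ∧ M.Decides {1, 3} c.1 off := by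
    intro j
    -- For large `k` the height exceeds `C + 2 + j`; since height plus `off 1` is at most `k + C +
    -- 1`, the gap between `off 0` and `off 1` exceeds `j`.
    obtain ⟨b₂, hb₂⟩ := (M.finite_zero_of_decides (F := {1, 3}) (by decide) (by decide)
      (by decide) (C + 2 + j)).bddAbove
    obtain ⟨c, off, h1, h2, h3, h4, h5⟩ := hsep (k₀ + b₁ + 1 + b₂) (by omega)
    have hlen : C + 2 + j < c.stack.length := by
      by_contra! hle
      have := hb₂ ⟨(by omega : 1 ≤ k₀ + b₁ + 1 + b₂), c, off, hle, h2, h3, h5⟩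
      omega
    -- The first block is completed to a match, and the second is long enough to empty the pushdown.
    have hw : nonemptyBlocks ![0, off 0 - off 1, 0, c.stack.length + 1] = {1, 3} := by
      ext i; fin_cases i <;> simp; omega
    obtain ⟨t, ht⟩ := (h5 ![0, off 0 - off 1, 0, c.stack.length + 1] hw (by simp)).2
      (by simp [InTarget]; omega)
    obtain ⟨c', off', k1, k2, k3, k4⟩ := hM.exists_empty hb h5 ht hw (by rw [h1]) (by omega)
      (by simp)
    exact ⟨⟨c', by simp [k1]⟩, off', by omega, k4⟩
  choose c off hoff hdec using hempty
  have := finite_stack_length_le (Q := Q) (Γ := Γ) 0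
  obtain ⟨y, hy⟩ := Finite.exists_infinite_fiber c
  have hy' := Set.infinite_coe_iff.1 hy
  obtain ⟨j, hj⟩ := hy'.nonempty
  obtain ⟨j', hj', hlt⟩ := hy'.exists_gt (off j 0)
  have heq : c j = c j' := hj.trans hj'.symm
  have hd' := hdec j'
  rw [← heq] at hd'
  have h1 := hoff j
  have h2 := hoff j'
  -- This closes the gap for `j` exactly, but not the larger gap for `j'`.
  have key := (hdec j).congr hd' (w := ![0, off j 0 - off j 1, 0, off j 0 + off j' 0 + 1])
    (by ext i; fin_cases i <;> simp; omega) (by simp)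
  simp [InTarget] at key
  omega

/-- It is impossible that, as long as no block is exhausted, infinitely many `a`s are read. -/
lemma Deterministic.not_read_a_forever [Finite Q] [Finite Γ] (hM : M.Deterministic)
    {run : ℕ → BlockConfig Q Γ} {e : ℕ → Option (Fin 4)}
    (hrun : ∀ t, M.advance Finset.univ (run t) = StepResult.go (e t, run (t + 1)))
    (he : ∀ t, e t = none ∨ e t = some 0 ∨ e t = some 1)
    (hinf : ∀ t, ∃ u, t ≤ u ∧ e u = some 0)
    (hdec : M.Decides Finset.univ (run 0) 0) : False := by
  set cnt : Fin 4 → ℕ → ℕ := fun i t => Nat.count (fun s => e s = some i) t with hcnt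
  have he2 : ∀ t, e t ≠ some 2 := fun t h => by
    rcases he t with h' | h' | h' <;> simp [h'] at h
  have hcnt3 : ∀ t, cnt 3 t = 0 := fun t => by
    rw [hcnt, Nat.count_iff_forall_not]
    intro s _ h
    rcases he s with h' | h' | h' <;> simp [h'] at h
  have hexh : ∀ t, e t = some 0 → M.Decides {1, 2, 3} (run (t + 1)) (fun i => cnt i (t + 1)) := by
    intro t ht
    have hF : (Finset.univ : Finset (Fin 4)).erase 0 = {1, 2, 3} := by decide
    have := hdec.run_exhaust hrun he2 ht
    rwa [hF, zero_add] at this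
  have hset : {s | e s = some 0}.Infinite :=
    Nat.frequently_atTop_iff_infinite.1 (Filter.frequently_atTop.2 hinf)
  set time : ℕ → ℕ := fun k => Nat.nth (fun s => e s = some 0) k with htime
  have hread : ∀ k, e (time k) = some 0 := fun k => Nat.nth_mem_of_infinite hset k
  have hctime : ∀ k, cnt 0 (time k) = k := fun k => Nat.count_nth_of_infinite hset k
  have hsucc : ∀ t, e t = some 0 → cnt 0 (t + 1) = cnt 0 t + 1 := fun t ht => by
    simp [hcnt, Nat.count_succ, ht]
  have hmono : ∀ i, Monotone (cnt i) := fun i => Nat.count_monotone _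
  by_cases hb : M.sig Letter.b = StackOp.pop
  · by_cases hempty : ∀ t, ∃ u, t ≤ u ∧ (run u).stack = []
    · have hinf' : {t | (run t).stack = []}.Infinite :=
        Nat.frequently_atTop_iff_infinite.1 (Filter.frequently_atTop.2 hempty)
      obtain ⟨s, hs, s', hs', hne, heq⟩ := hinf'.exists_ne_map_eq_of_mapsTo
        (f := fun t => ((run t).pos, (run t).state)) (Set.mapsTo_univ _ _) Set.finite_univ
      wlog hlt : s < s' generalizing s s'
      · exact this s' hs' s hs hne.symm heq.symm (by omega)
      obtain ⟨h1, h2⟩ := Prod.mk.inj heq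
      -- With the pushdown empty, position and state are the whole configuration, so the run
      -- repeats.
      have hper : ∀ r, run (s + r) = run (s' + r) := by
        intro r
        induction r with
        | zero => exact BlockConfig.ext h1 h2 (Eq.trans hs (Eq.symm hs'))
        | succ r ih =>
          have h := hrun (s + r)
          rw [ih, hrun (s' + r)] at h
          simp only [StepResult.go.injEq, Prod.mk.injEq] at h
          exact h.2.symm
      obtain ⟨u, hu, heu⟩ := hinf s
      obtain ⟨r, rfl⟩ := Nat.exists_eq_add_of_le hu
      have heu' : e (s' + r) = some 0 := by
        have h := hrun (s + r)
        rw [hper, hrun (s' + r)] at h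
        simp only [StepResult.go.injEq, Prod.mk.injEq] at h
        rw [h.1, heu]
      have hd := hexh _ heu
      have hd' := hexh _ heu'
      rw [show run (s + r + 1) = run (s' + r + 1) from hper (r + 1)] at hd
      have : cnt 0 (s + r + 1) = cnt 0 (s' + r + 1) :=
        hd.zero_eq_of_notMem hd' (by decide) (by decide) (by decide) (hcnt3 _) (hcnt3 _)
          (by rw [hsucc _ heu]; omega)
      rw [hsucc _ heu'] at this
      have := hmono 0 (show s + r + 1 ≤ s' + r by omega)
      omega
    · push Not at hempty
      obtain ⟨t₀, ht₀⟩ := hempty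
      -- The pushdown is never empty here, so each `b` really lowers the height.
      have hheight : ∀ t, t₀ ≤ t →
          (run t).stack.length + cnt 1 t ≤ cnt 0 t + ((run t₀).stack.length + cnt 1 t₀) := by
        intro t ht
        induction t, ht using Nat.le_induction with
        | base => omega
        | succ t ht ih =>
          have hact := (advance_eq_go (hrun t)).2.2
          have hlen := List.length_pos_iff.2 (ht₀ t ht)
          simp only [hcnt, Nat.count_succ] at ih ⊢
          rcases he t with h | h | h
          · rw [advance_stack_none (h ▸ hrun t)]
            simpa [h] using ih
          · have := act_length_le hact
            simp [h]
            omega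
          · rw [h] at hact
            have : (run (t + 1)).stack.length = (run t).stack.length - 1 := by
              rw [act_pop hb hact, List.length_tail]
            simp [h]
            omega
      refine hM.not_decides_pop hb (k₀ := cnt 0 t₀ + 1)
        (C := (run t₀).stack.length + cnt 1 t₀) fun k hk => ?_
      have hk1 : cnt 0 (time (k - 1) + 1) = k := by
        rw [hsucc _ (hread _), hctime]
        omega
      refine ⟨run (time (k - 1) + 1), _, ?_, hk1, hcnt3 _, ?_, hexh _ (hread _)⟩
      · have := advance_pos (hrun (time (k - 1)))
        rw [hread] at this
        exact this
      · have hle : t₀ ≤ time (k - 1) + 1 := by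
          by_contra! hlt
          have := hmono 0 hlt.le
          omega
        have := hheight _ hle
        rw [hk1] at this
        exact this
  -- After the last `a` only the separator can pop, at most once. Hence the state and the two
  -- topmost symbols decide acceptance.
  · have hfin : Finite {γ : List Γ // γ.length ≤ 2} := List.finite_length_le Γ 2
    obtain ⟨k, k', hne, heq⟩ := Finite.exists_ne_map_eq_of_infinite
      (fun k => (((run (time k + 1)).state,
        ⟨(run (time k + 1)).stack.take 2, by simp⟩) : Q × {γ : List Γ // γ.length ≤ 2}))
    simp only [Prod.mk.injEq, Subtype.mk.injEq] at heq
    have hpos : ∀ k, (run (time k + 1)).pos = 0 := fun k => by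
      have := advance_pos (hrun (time k))
      rw [hread] at this
      exact this
    have hd' : M.Decides {1, 2, 3} (run (time k + 1)) (fun i => cnt i (time k' + 1)) := by
      intro w hw hw2
      rw [← hexh _ (hread k') w hw hw2]
      have h0 : w 0 = 0 := by
        have : 0 ∉ nonemptyBlocks w := by rw [hw]; decide
        simpa using this
      have hbudget : M.popBudget w < 2 := by
        have hb1 : M.sig (blockLetter 1) ≠ StackOp.pop := hb
        have hb3 : M.sig (blockLetter 3) ≠ StackOp.pop := hb
        simp only [popBudget, Fin.sum_univ_four, hb1, hb3, if_false, h0, ite_self]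
        split_ifs <;> omega
      have := M.accepts_take_congr (p := 0) (q := (run (time k + 1)).state) hbudget heq.2
      have h1 := hpos k
      have h2 := hpos k'
      have h3 := heq.1
      generalize run (time k + 1) = c at *
      generalize run (time k' + 1) = c' at *
      obtain ⟨p, q, γ⟩ := c
      obtain ⟨p', q', γ'⟩ := c'
      simp only at h1 h2 h3 this
      subst h1 h2 h3
      exact this
    have := (hexh _ (hread k)).zero_eq_of_notMem hd' (by decide) (by decide) (by decide) (hcnt3 _)
      (hcnt3 _) (by rw [hsucc _ (hread k)]; omega)
    rw [hsucc _ (hread k), hsucc _ (hread k'), hctime, hctime] at this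
    omega

/-! ### The contradiction for deterministic automata -/

/-- No deterministic automaton in the non-returning mode decides the target. -/
theorem Deterministic.not_decides [Finite Q] [Finite Γ] (hM : M.Deterministic) {q : Q}
    {γ : List Γ} : ¬ M.Decides Finset.univ ⟨0, q, γ⟩ 0 := by
  intro hdec
  -- The default value `c` is never relied upon; only `go` steps are followed.
  set next : Finset (Fin 4) → BlockConfig Q Γ → BlockConfig Q Γ := fun F c =>
    match M.advance F c with
    | StepResult.go r => r.2
    | _ => c with hnext
  have hnext_go : ∀ {F c e c'}, M.advance F c = StepResult.go (e, c') → next F c = c' := by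
    intro F c e c' h
    simp only [hnext, h]
  set run : ℕ → BlockConfig Q Γ := fun t => (next Finset.univ)^[t] ⟨0, q, γ⟩ with hrundef
  have hrun_succ : ∀ t, run (t + 1) = next Finset.univ (run t) := fun t =>
    Function.iterate_succ_apply' _ _ _
  have hpos_step : ∀ {c c' : BlockConfig Q Γ} {e}, c.pos ≤ 1 →
      M.advance Finset.univ c = StepResult.go (e, c') → e ≠ some 2 →
      (e = none ∨ e = some 0 ∨ e = some 1) ∧ c'.pos ≤ 1 := by
    intro c c' e hc h he
    have hp := advance_pos h
    rcases e with _ | i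
    · exact ⟨Or.inl rfl, by rw [hp]; decide⟩
    · have h3 : i ≠ 3 := by
        rintro rfl
        exact advance_ne_three (by simp) hc h
      have h2 : i ≠ 2 := fun h => he (by rw [h])
      rw [hp]
      revert h2 h3
      clear * -
      revert i
      decide
  -- Either the common run never reads the separator, or it reads it while all other blocks are
  -- nonempty.
  by_cases hgood : ∀ t, ∃ e, M.advance Finset.univ (run t) = StepResult.go (e, run (t + 1)) ∧
      e ≠ some 2
  · choose e hrun he2 using hgood
    have hpos : ∀ t, (run t).pos ≤ 1 := by
      intro t
      induction t with
      | zero => exact Fin.zero_le _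
      | succ t ih => exact (hpos_step ih (hrun t) (he2 t)).2
    have he := fun t => (hpos_step (hpos t) (hrun t) (he2 t)).1
    have hdect := fun t => Decides.run (run := run) hdec hrun he2 t
    by_cases hinf0 : ∀ t, ∃ u, t ≤ u ∧ e u = some 0
    · exact hM.not_read_a_forever hrun he hinf0 hdec
    push Not at hinf0
    obtain ⟨t₀, ht₀⟩ := hinf0
    by_cases hinf1 : ∀ t, ∃ u, t ≤ u ∧ e u = some 1
    · refine Decides.not_read_forever (n := 1) (n' := 3) (by simp) (Finset.mem_univ _)
        (Finset.mem_univ _) (run := fun t => run (t₀ + t)) (e := fun t => e (t₀ + t))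
        (fun t => hrun (t₀ + t)) (fun t => ?_) (fun t => ?_) (hdect t₀)
      · have := he (t₀ + t)
        have := ht₀ (t₀ + t) (by omega)
        tauto
      · obtain ⟨u, hu, heu⟩ := hinf1 (t₀ + t)
        exact ⟨u - t₀, by omega, by rwa [Nat.add_sub_cancel' (by omega)]⟩
    · push Not at hinf1
      obtain ⟨t₁, ht₁⟩ := hinf1
      obtain ⟨t, ht⟩ := (hdect (t₀ + t₁)).exists_event (Finset.mem_univ _) (Finset.mem_univ _)
        (Finset.mem_univ _) (run := fun t => run (t₀ + t₁ + t)) (e := fun t => e (t₀ + t₁ + t)) rfl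
        (fun t => hrun (t₀ + t₁ + t))
      have := he (t₀ + t₁ + t)
      have := ht₀ (t₀ + t₁ + t) (by omega)
      have := ht₁ (t₀ + t₁ + t) (by omega)
      tauto
  · have hbad : ∃ (c : BlockConfig Q Γ) (off : Fin 4 → ℕ), M.Decides {0, 1, 3} c off ∧
        2 ≤ c.pos := by
      by_contra! hno
      have hall : ∀ t, (run t).pos ≤ 1 ∧ ∃ off, M.Decides Finset.univ (run t) off := by
        intro t
        induction t with
        | zero => exact ⟨Fin.zero_le _, 0, hdec⟩
        | succ t ih =>
          obtain ⟨hp, off, hd⟩ := ih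
          rcases ha : M.advance Finset.univ (run t) with _ | _ | ⟨e, c'⟩
          · exact absurd ha (hd.ne_accept (Finset.mem_univ _))
          · exact absurd ha (hd.ne_stuck (Finset.mem_univ _) (Finset.mem_univ _)
              (Finset.mem_univ _))
          · rw [hrun_succ, hnext_go ha]
            have he2 : e ≠ some 2 := by
              rintro rfl
              have hd' := hd.advance_exhaust ha
              have hF : (Finset.univ : Finset (Fin 4)).erase 2 = {0, 1, 3} := by decide
              rw [hF] at hd'
              exact absurd (advance_pos ha).ge (not_le.2 (hno _ _ hd'))
            refine ⟨(hpos_step hp ha he2).2, ?_⟩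
            rcases e with _ | i
            · exact ⟨_, hd.advance_none ha⟩
            · exact ⟨_, hd.advance_some ha (fun h => he2 (by rw [h]))⟩
      refine hgood fun t => ?_
      obtain ⟨hp, off, hd⟩ := hall t
      rcases ha : M.advance Finset.univ (run t) with _ | _ | ⟨e, c'⟩
      · exact absurd ha (hd.ne_accept (Finset.mem_univ _))
      · exact absurd ha (hd.ne_stuck (Finset.mem_univ _) (Finset.mem_univ _) (Finset.mem_univ _))
      · refine ⟨e, by rw [hrun_succ, hnext_go ha], ?_⟩
        rintro rfl
        have hd' := hd.advance_exhaust ha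
        have hF : (Finset.univ : Finset (Fin 4)).erase 2 = {0, 1, 3} := by decide
        rw [hF] at hd'
        exact absurd (advance_pos ha).ge (not_le.2 (hno _ _ hd'))
    obtain ⟨c, off, hd, hp⟩ := hbad
    -- A return to the left end would merge the `b`-blocks, and right of the head only the second
    -- one is left.
    have hstep : ∀ {c : BlockConfig Q Γ} {off}, M.Decides {0, 1, 3} c off → 2 ≤ c.pos →
        ∃ c', M.advance {0, 1, 3} c = StepResult.go (some 3, c') := by
      intro c off hd hp
      rcases ha : M.advance {0, 1, 3} c with _ | _ | ⟨e, c'⟩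
      · exact absurd ha (hd.ne_accept (by decide))
      · exact absurd ha (hd.ne_stuck (by decide) (by decide) (by decide))
      · rcases e with _ | i
        · exact (hM.not_decides_left_of_zero_mem (hd.advance_none ha) (advance_pos ha)).elim
        · have hi := advance_mem ha
          have hle := hp.trans (advance_pos_le ha)
          obtain rfl : i = 3 := by
            clear * - hi hle
            revert i
            decide
          exact ⟨c', rfl⟩
    set run' : ℕ → BlockConfig Q Γ := fun t => (next {0, 1, 3})^[t] c with hrundef'
    have hrun_succ' : ∀ t, run' (t + 1) = next {0, 1, 3} (run' t) := fun t =>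
      Function.iterate_succ_apply' _ _ _
    have hall : ∀ t, 2 ≤ (run' t).pos ∧ ∃ off, M.Decides {0, 1, 3} (run' t) off := by
      intro t
      induction t with
      | zero => exact ⟨hp, off, hd⟩
      | succ t ih =>
        obtain ⟨hp, off, hd⟩ := ih
        obtain ⟨c', ha⟩ := hstep hd hp
        rw [hrun_succ', hnext_go ha]
        exact ⟨by rw [advance_pos ha]; decide, _, hd.advance_some ha (by decide)⟩
    refine Decides.not_read_forever (n := 3) (n' := 1) (F := {0, 1, 3}) (by simp) (by decide)
      (by decide) (run := run') (e := fun _ => some 3) (fun t => ?_) (fun _ => Or.inr rfl)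
      (fun t => ⟨t, le_rfl, rfl⟩) hd
    obtain ⟨hp, off, hd⟩ := hall t
    obtain ⟨c', ha⟩ := hstep hd hp
    rw [hrun_succ', hnext_go ha, ha]

end IDPDA

/-! ### Simulating the returning mode -/

section Rewinding

variable {A Q Γ : Type}

namespace Outcome

variable {β β' : Type}

def map (f : β → β') : Outcome β → Outcome β'
  | accept => accept
  | moves s => moves (f '' s)

lemma map_eq_accept {f : β → β'} {o : Outcome β} : o.map f = accept ↔ o = accept := by
  cases o <;> simp [map]

lemma allows_map {f : β → β'} {o : Outcome β} {b : β'} :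
    (o.map f).Allows b ↔ ∃ a, o.Allows a ∧ f a = b := by
  cases o <;> simp [map, Allows]

lemma AtMostOne.map {o : Outcome β} (ho : o.AtMostOne) (f : β → β') : (o.map f).AtMostOne := by
  cases o with
  | accept => trivial
  | moves s => exact Set.Subsingleton.image ho f

end Outcome

namespace IDPDA

/-- The automaton that moves the head to the left end by an endmarker step after each step of `M`.
The Boolean component of a state says whether this step is due. -/
def rewind (M : IDPDA A Q Γ) : IDPDA A (Q × Bool) Γ where
  sig := M.sig
  start := (M.start, false)
  -- In a flagged state no letter is visible, so the endmarker is processed at once.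
  τ q := if q.2 then Set.univ else M.τ q.1
  δD q a z := (M.δD q.1 a z).map fun r => ((r.1, true), r.2)
  δR q a z := (M.δR q.1 a z).map fun q' => (q', true)
  δN q s z := if q.2 then Outcome.moves {(q.1, false)} else (M.δN q.1 s z).map fun q' => (q', true)

lemma Deterministic.rewind {M : IDPDA A Q Γ} (hM : M.Deterministic) :
    M.rewind.Deterministic := by
  rintro ⟨q, r⟩ z
  obtain ⟨h1, h2, h3, h4⟩ := hM q z
  refine ⟨fun a ha => (h1 a ha).map _, fun a ha => (h2 a ha).map _, fun a ha => ?_, ?_⟩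
  · cases r
    · exact (h3 a ha).map _
    · exact Set.subsingleton_singleton
  · cases r
    · exact h4.map _
    · exact Set.subsingleton_singleton

lemma rewind_move_iff {M : IDPDA A Q Γ} {q : Q} {a : A} {γ γ' : List Γ} {r : Q × Bool} :
    M.rewind.Move (q, false) a γ r γ' ↔ r.2 = true ∧ M.Move q a γ r.1 γ' := by
  obtain ⟨q', b⟩ := r
  constructor
  · rintro (⟨ha, h⟩ | ⟨ha, h⟩ | ⟨ha, h⟩)
    · obtain ⟨x, hx, h⟩ := Outcome.allows_map.1 h
      simp only [Prod.mk.injEq] at h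
      obtain ⟨⟨rfl, rfl⟩, rfl⟩ := h
      exact ⟨rfl, Move.push ha hx⟩
    · obtain ⟨x, hx, h⟩ := Outcome.allows_map.1 h
      simp only [Prod.mk.injEq] at h
      obtain ⟨rfl, rfl⟩ := h
      exact ⟨rfl, Move.pop ha hx⟩
    · obtain ⟨x, hx, h⟩ := Outcome.allows_map.1 h
      simp only [Prod.mk.injEq] at h
      obtain ⟨rfl, rfl⟩ := h
      exact ⟨rfl, Move.keep ha hx⟩
  · rintro ⟨hb, h⟩
    obtain rfl : b = true := hb
    rcases h with ⟨ha, h⟩ | ⟨ha, h⟩ | ⟨ha, h⟩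
    · exact Move.push ha (Outcome.allows_map.2 ⟨_, h, rfl⟩)
    · exact Move.pop ha (Outcome.allows_map.2 ⟨_, h, rfl⟩)
    · exact Move.keep ha (Outcome.allows_map.2 ⟨_, h, rfl⟩)

lemma rewind_acceptsOn_iff {M : IDPDA A Q Γ} {q : Q} {a : A} {γ : List Γ} :
    M.rewind.AcceptsOn (q, false) a γ ↔ M.AcceptsOn q a γ := by
  unfold AcceptsOn
  rcases ha : M.sig a <;> simp [rewind, ha, Outcome.map_eq_accept]

lemma rewind_step (M : IDPDA A Q Γ) (q : Q) (u w : List A) (γ : List Γ) :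
    M.rewind.NRStep (NRConfig.run u (q, true) w γ) (NRConfig.run [] (q, false) (u ++ w) γ) :=
  NRStep.endmarker (fun _ _ => by simp [rewind]) (by simp [rewind, Outcome.Allows])

/-- The configuration of `M` that a configuration of `M.rewind` stands for. -/
def unwind : NRConfig A (Q × Bool) Γ → Config A Q Γ
  | NRConfig.run u q w γ => Config.run q.1 (u ++ w) γ
  | NRConfig.accept => Config.accept

/-- The configurations of `M.rewind` that can be reached from initial ones. -/
def Rewound : NRConfig A (Q × Bool) Γ → Prop
  | NRConfig.run u q _ _ => q.2 = false → u = []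
  | NRConfig.accept => True

/-- A due endmarker step disappears under `unwind`. Any other step starts at the left end by
`Rewound`, where both modes process the same letter. -/
lemma unwind_step {M : IDPDA A Q Γ} {c d : NRConfig A (Q × Bool) Γ} (hc : Rewound c)
    (h : M.rewind.NRStep c d) :
    Relation.ReflTransGen M.Step (unwind c) (unwind d) ∧ Rewound d := by
  cases h with
  | @read q q' u x y a γ γ' hx ha h =>
    obtain ⟨q, r⟩ := q
    cases r with
    | true => simp [rewind] at ha
    | false =>
      obtain rfl : u = [] := hc rfl
      obtain ⟨hq', h⟩ := rewind_move_iff.1 h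
      exact ⟨Relation.ReflTransGen.single (Step.read hx ha h), fun hf => by simp [hq'] at hf⟩
  | @readAccept q u x y a γ hx ha h =>
    obtain ⟨q, r⟩ := q
    cases r with
    | true => simp [rewind] at ha
    | false =>
      obtain rfl : u = [] := hc rfl
      exact ⟨Relation.ReflTransGen.single
        (Step.readAccept hx ha (rewind_acceptsOn_iff.1 h)), trivial⟩
  | @endmarker q q' u x γ hx h =>
    obtain ⟨q, r⟩ := q
    refine ⟨?_, fun _ => rfl⟩
    cases r with
    | true =>
      obtain rfl : q' = (q, false) := h
      exact Relation.ReflTransGen.refl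
    | false =>
      obtain rfl : u = [] := hc rfl
      obtain ⟨p, hp, rfl⟩ := Outcome.allows_map.1 h
      exact Relation.ReflTransGen.single (Step.endmarker hx hp)
  | @endAccept q u x γ hx h =>
    obtain ⟨q, r⟩ := q
    cases r with
    | true => simp [rewind] at h
    | false =>
      obtain rfl : u = [] := hc rfl
      exact ⟨Relation.ReflTransGen.single (Step.endAccept hx (Outcome.map_eq_accept.1 h)), trivial⟩

/-- Each non-accepting step becomes two: its copy and the return to the left end, superfluous after
an endmarker step. -/
lemma step_rewind {M : IDPDA A Q Γ} {q : Q} {w : List A} {γ : List Γ} {d : Config A Q Γ}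
    (h : M.Step (Config.run q w γ) d) : ∃ d', unwind d' = d ∧
      (∀ q' w' γ', d = Config.run q' w' γ' → d' = NRConfig.run [] (q', false) w' γ') ∧
      Relation.ReflTransGen M.rewind.NRStep (NRConfig.run [] (q, false) w γ) d' := by
  cases h with
  | @read _ q' x y a _ γ' hx ha h =>
    refine ⟨NRConfig.run [] (q', false) (x ++ y) γ', rfl, ?_, ?_⟩
    · rintro _ _ _ h
      cases h
      rfl
    · exact (Relation.ReflTransGen.single (NRStep.read (M := M.rewind) (u := []) (q := (q, false))
        (q' := (q', true)) hx ha (rewind_move_iff.2 ⟨rfl, h⟩))).tail (M.rewind_step q' _ _ _)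
  | readAccept hx ha h =>
    exact ⟨NRConfig.accept, rfl, fun _ _ _ h => (by cases h), Relation.ReflTransGen.single
      (NRStep.readAccept (M := M.rewind) (q := (q, false)) hx ha (rewind_acceptsOn_iff.2 h))⟩
  | @endmarker _ q' _ _ hx h =>
    refine ⟨NRConfig.run [] (q', false) w γ, rfl, ?_, ?_⟩
    · rintro _ _ _ h
      cases h
      rfl
    · exact (Relation.ReflTransGen.single (NRStep.endmarker (M := M.rewind) (u := [])
        (q := (q, false)) (q' := (q', true)) hx
        (Outcome.allows_map.2 ⟨q', h, rfl⟩))).tail (M.rewind_step q' _ _ _)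
  | endAccept hx h =>
    exact ⟨NRConfig.accept, rfl, fun _ _ _ h => (by cases h), Relation.ReflTransGen.single
      (NRStep.endAccept (M := M.rewind) (q := (q, false)) hx (Outcome.map_eq_accept.2 h))⟩

theorem rewind_nrLang (M : IDPDA A Q Γ) : M.rewind.nrLang = M.lang := by
  ext w
  constructor
  · intro h
    have key : ∀ d, Relation.ReflTransGen M.rewind.NRStep
        (NRConfig.run [] (M.start, false) w []) d →
        Relation.ReflTransGen M.Step (Config.run M.start w []) (unwind d) ∧ Rewound d := by
      intro d hd
      induction hd with
      | refl => exact ⟨Relation.ReflTransGen.refl, fun _ => rfl⟩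
      | tail _ h ih =>
        obtain ⟨h1, h2⟩ := unwind_step ih.2 h
        exact ⟨ih.1.trans h1, h2⟩
    exact (key _ h).1
  · intro h
    have key : ∀ c, Relation.ReflTransGen M.Step c Config.accept → ∀ q v γ,
        c = Config.run q v γ → Relation.ReflTransGen M.rewind.NRStep
          (NRConfig.run [] (q, false) v γ) NRConfig.accept := by
      intro c hc
      induction hc using Relation.ReflTransGen.head_induction_on with
      | refl => intro q v γ h; cases h
      | @head c d h _ ih =>
        rintro q v γ rfl
        obtain ⟨d', hd, hd', hr⟩ := step_rewind h
        cases d with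
        | run q' v' γ' =>
          rw [hd' q' v' γ' rfl] at hr
          exact hr.trans (ih q' v' γ' rfl)
        | accept =>
          cases d' with
          | run => cases hd
          | accept => exact hr
    exact key _ h _ _ _ rfl

end IDPDA

theorem NIDPDAwtl_subset_nrNIDPDAwtl (A : Type) : NIDPDAwtl A ⊆ nrNIDPDAwtl A := by
  rintro L ⟨Q, Γ, _, hΓ, M, rfl⟩
  exact ⟨Q × Bool, Γ, inferInstance, hΓ, M.rewind, M.rewind_nrLang⟩

theorem DIDPDAwtl_subset_nrDIDPDAwtl (A : Type) : DIDPDAwtl A ⊆ nrDIDPDAwtl A := by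
  rintro L ⟨Q, Γ, _, hΓ, M, hM, rfl⟩
  exact ⟨Q × Bool, Γ, inferInstance, hΓ, M.rewind, hM.rewind, M.rewind_nrLang⟩

end Rewinding

/-! ### The witness language without shuffles -/

section Witness

/-- The word without its `a`s. -/
def withoutA (w : List Letter) : List Letter := w.filter (· ≠ Letter.a)

lemma withoutA_append (x y : List Letter) : withoutA (x ++ y) = withoutA x ++ withoutA y :=
  List.filter_append _ _

lemma withoutA_eq_nil {x : List Letter} : withoutA x = [] ↔ ∀ c ∈ x, c = Letter.a := by
  simp [withoutA]

lemma withoutA_cons_a (x : List Letter) : withoutA (Letter.a :: x) = withoutA x := by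
  simp [withoutA]

lemma withoutA_cons {c : Letter} (hc : c ≠ Letter.a) (x : List Letter) :
    withoutA (c :: x) = c :: withoutA x := by
  simp [withoutA, hc]

/-- As `a` does not occur in `u`, each letter of `w` reveals the factor it comes from. -/
lemma mem_shuffle_replicate_a {w u : List Letter} {n : ℕ} (hu : Letter.a ∉ u) :
    w ∈ shuffle {u} {List.replicate n Letter.a} ↔ withoutA w = u ∧ w.count Letter.a = n := by
  constructor
  · rintro ⟨p, h1, h2, rfl⟩
    replace h1 : (p.map Prod.fst).flatten = u := h1
    replace h2 : (p.map Prod.snd).flatten = List.replicate n Letter.a := h2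
    have hfst : ∀ xy ∈ p, Letter.a ∉ xy.1 := fun xy hxy h =>
      hu (h1 ▸ List.mem_flatten.2 ⟨xy.1, List.mem_map_of_mem hxy, h⟩)
    have hsnd : ∀ xy ∈ p, ∀ c ∈ xy.2, c = Letter.a := fun xy hxy c hc =>
      List.eq_of_mem_replicate
        (h2 ▸ List.mem_flatten.2 ⟨xy.2, List.mem_map_of_mem hxy, hc⟩)
    have h3 := congrArg List.length h2
    rw [List.length_replicate] at h3
    rw [← h1, ← h3]
    clear h1 h2 h3
    induction p with
    | nil => simp [withoutA]
    | cons xy p ih =>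
      obtain ⟨ih1, ih2⟩ := ih (fun z hz => hfst z (by simp [hz])) (fun z hz => hsnd z (by simp [hz]))
      have ha := hfst xy (by simp)
      have hb := hsnd xy (by simp)
      have h4 : withoutA xy.1 = xy.1 := by
        rw [withoutA, List.filter_eq_self]
        intro c hc
        simpa using fun h : c = Letter.a => ha (h ▸ hc)
      have h5 : xy.2.count Letter.a = xy.2.length := List.count_eq_length.2 fun c hc => (hb c hc).symm
      simp only [List.map_cons, List.flatten_cons, withoutA_append, List.count_append,
        List.length_append, ih1, ih2, h4, h5, withoutA_eq_nil.2 hb, List.append_nil,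
        List.count_eq_zero_of_not_mem ha, zero_add, and_self]
  · rintro ⟨rfl, rfl⟩
    refine ⟨w.map fun c => if c = Letter.a then ([], [c]) else ([c], []), ?_, ?_, ?_⟩
    · show _ = _
      induction w with
      | nil => rfl
      | cons c w ih =>
        by_cases hc : c = Letter.a
        · subst hc
          simpa [withoutA_cons_a] using ih (by simpa [withoutA_cons_a] using hu)
        · simpa [withoutA_cons hc, hc] using ih fun h => hu (by simp [withoutA_cons hc, h])
    · show _ = _
      clear hu
      induction w with
      | nil => rfl
      | cons c w ih =>
        by_cases hc : c = Letter.a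
        · subst hc
          simpa [List.replicate_succ] using ih
        · simpa [hc] using ih
    · clear hu
      induction w with
      | nil => rfl
      | cons c w ih =>
        by_cases hc : c = Letter.a <;> simpa [hc] using ih

/-- The words `bⁱ # bʲ`. -/
def separated (i j : ℕ) : List Letter :=
  List.replicate i Letter.b ++ Letter.hash :: List.replicate j Letter.b

lemma a_notMem_separated (i j : ℕ) : Letter.a ∉ separated i j := by
  simp [separated, List.mem_replicate]

lemma mem_witness {w : List Letter} : w ∈ witness ↔ ∃ i j, 1 ≤ i ∧ 1 ≤ j ∧
    withoutA w = separated i j ∧ (w.count Letter.a = i ∨ w.count Letter.a = j) := by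
  have key : ∀ i j n, w ∈ shuffle {List.replicate i Letter.b ++ [Letter.hash] ++
      List.replicate j Letter.b} {List.replicate n Letter.a} ↔
      withoutA w = separated i j ∧ w.count Letter.a = n := by
    intro i j n
    rw [← mem_shuffle_replicate_a (a_notMem_separated i j)]
    simp [separated]
  rw [witness, Language.mem_add]
  constructor
  · rintro (⟨m, n, hm, hn, h⟩ | ⟨m, n, hm, hn, h⟩)
    · obtain ⟨h1, h2⟩ := (key _ _ _).1 h
      exact ⟨n, m, hn, hm, h1, Or.inl h2⟩
    · obtain ⟨h1, h2⟩ := (key _ _ _).1 h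
      exact ⟨m, n, hm, hn, h1, Or.inr h2⟩
  · rintro ⟨i, j, hi, hj, h1, h2 | h2⟩
    · exact Or.inl ⟨j, i, hj, hi, (key _ _ _).2 ⟨h1, h2⟩⟩
    · exact Or.inr ⟨i, j, hi, hj, (key _ _ _).2 ⟨h1, h2⟩⟩

lemma separated_injective {i j i' j' : ℕ} (h : separated i j = separated i' j') :
    i = i' ∧ j = j' := by
  have h1 := append_cons_unique (P := fun c => c = Letter.b) h
    (fun c hc => List.eq_of_mem_replicate hc) (by decide)
    (fun c hc => List.eq_of_mem_replicate hc) (by decide)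
  exact ⟨by simpa using congrArg List.length h1.1, by simpa using congrArg List.length h1.2.2⟩

lemma blocksFrom_zero_mem_witness {v : Fin 4 → ℕ} (hv : v 2 = 1) :
    blocksFrom v 0 ∈ witness ↔ InTarget v := by
  have hfin : List.finRange 4 = [0, 1, 2, 3] := by decide
  have hw : blocksFrom v 0 = List.replicate (v 0) Letter.a ++ separated (v 1) (v 3) := by
    simp [blocksFrom, blocks, hfin, blockLetter, hv, separated]
  have h1 : withoutA (blocksFrom v 0) = separated (v 1) (v 3) := by
    rw [hw, withoutA_append, withoutA_eq_nil.2 fun c hc => List.eq_of_mem_replicate hc,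
      List.nil_append, withoutA, List.filter_eq_self]
    intro c hc
    simpa using fun h : c = Letter.a => a_notMem_separated _ _ (h ▸ hc)
  have h2 : (blocksFrom v 0).count Letter.a = v 0 := by
    rw [hw, List.count_append, List.count_replicate_self,
      List.count_eq_zero_of_not_mem (a_notMem_separated _ _), add_zero]
  rw [mem_witness, h1, h2, InTarget]
  constructor
  · rintro ⟨i, j, hi, hj, h, h'⟩
    obtain ⟨rfl, rfl⟩ := separated_injective h
    exact ⟨hi, hj, h'⟩
  · rintro ⟨hi, hj, h⟩
    exact ⟨_, _, hi, hj, rfl, h⟩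

theorem witness_notMem_nrDIDPDAwtl : witness ∉ nrDIDPDAwtl Letter := by
  rintro ⟨Q, Γ, _, _, M, hM, hL⟩
  refine hM.not_decides (q := M.start) (γ := []) fun w hw hw2 => ?_
  have h2 : w 2 = 1 := by
    have : 2 ∈ nonemptyBlocks w := by rw [hw]; exact Finset.mem_univ _
    rw [mem_nonemptyBlocks] at this
    omega
  rw [zero_add, ← blocksFrom_zero_mem_witness h2, ← hL, hM.accepts_iff_reach]
  rfl

end Witness

/-! ### A nondeterministic automaton for the witness language -/

section Acceptor

/-- The states of an automaton for the witness language. Having read one `b`, it guesses which of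
the two blocks of `b`s is to be matched with the `a`s. -/
inductive WitnessState where
  | start
  /-- first block: an `a` has to be read -/
  | firstA
  /-- first block: the numbers of `a`s and `b`s read agree -/
  | firstB
  /-- first block: the separator has been read -/
  | tail
  /-- first block: the separator and a further `b` have been read -/
  | rest
  /-- second block: the first block is being read -/
  | skip
  /-- second block: the separator has been read -/
  | secondStart
  /-- second block: an `a` has to be read -/
  | secondA
  /-- second block: the numbers of `a`s and `b`s read agree -/
  | secondB
  /-- the input has to be empty -/
  | final
  deriving DecidableEq

namespace WitnessState

instance : Fintype WitnessState :=
  ⟨{start, firstA, firstB, tail, rest, skip, secondStart, secondA, secondB, final}, by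
    intro s; cases s <;> simp⟩

/-- In `rest` and `secondB` the letter `a` is translucent, so meeting the endmarker does not show
that the input is empty. This is checked in `final`, where nothing is translucent. -/
def next : WitnessState → Option Letter → Outcome WitnessState
  | start, some Letter.b => Outcome.moves {firstA, skip}
  | firstA, some Letter.a => Outcome.moves {firstB}
  | firstB, some Letter.b => Outcome.moves {firstA}
  | firstB, some Letter.hash => Outcome.moves {tail}
  | tail, some Letter.b => Outcome.moves {rest}
  | rest, some Letter.b => Outcome.moves {rest}
  | rest, none => Outcome.moves {final}
  | skip, some Letter.b => Outcome.moves {skip}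
  | skip, some Letter.hash => Outcome.moves {secondStart}
  | secondStart, some Letter.b => Outcome.moves {secondA}
  | secondA, some Letter.a => Outcome.moves {secondB}
  | secondB, some Letter.b => Outcome.moves {secondA}
  | secondB, none => Outcome.moves {final}
  | final, none => Outcome.accept
  | _, _ => Outcome.moves ∅

def translucent : WitnessState → Set Letter
  | firstA => {Letter.b, Letter.hash}
  | secondA => {Letter.b, Letter.hash}
  | final => ∅
  | _ => {Letter.a}

/-- The inputs accepted from a state, in terms of the word without its `a`s and their number. -/
def Accepted : WitnessState → List Letter → ℕ → Prop
  | start, u, n => ∃ i j, 1 ≤ i ∧ 1 ≤ j ∧ u = separated i j ∧ (n = i ∨ n = j)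
  | firstA, u, n => ∃ i j, 1 ≤ j ∧ u = separated i j ∧ n = i + 1
  | firstB, u, n => ∃ i j, 1 ≤ j ∧ u = separated i j ∧ n = i
  | tail, u, n => ∃ j, u = List.replicate (j + 1) Letter.b ∧ n = 0
  | rest, u, n => ∃ j, u = List.replicate j Letter.b ∧ n = 0
  | skip, u, n => ∃ i j, 1 ≤ j ∧ u = separated i j ∧ n = j
  | secondStart, u, n => ∃ j, u = List.replicate (j + 1) Letter.b ∧ n = j + 1
  | secondA, u, n => ∃ j, u = List.replicate j Letter.b ∧ n = j + 1
  | secondB, u, n => ∃ j, u = List.replicate j Letter.b ∧ n = j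
  | final, u, n => u = [] ∧ n = 0

end WitnessState

open WitnessState

def witnessAutomaton : IDPDA Letter WitnessState Empty where
  sig _ := StackOp.keep
  start := start
  τ := translucent
  δD _ _ _ := Outcome.moves ∅
  δR _ _ _ := Outcome.moves ∅
  δN s c _ := next s c

lemma separated_succ (i j : ℕ) : separated (i + 1) j = Letter.b :: separated i j := by
  simp [separated, List.replicate_succ]

namespace WitnessState

lemma accepted_of_read_a {s s' : WitnessState} {u : List Letter} {n : ℕ}
    (h : (next s (some Letter.a)).Allows s') (h' : s'.Accepted u n) : s.Accepted u (n + 1) := by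
  cases s <;> simp only [next, Outcome.Allows, Set.mem_singleton_iff, Set.mem_empty_iff_false] at h
  · subst h
    obtain ⟨i, j, hj, rfl, rfl⟩ := h'
    exact ⟨n, j, hj, rfl, rfl⟩
  · subst h
    obtain ⟨j, rfl, rfl⟩ := h'
    exact ⟨n, rfl, rfl⟩

lemma accepted_of_read_b {s s' : WitnessState} {u : List Letter} {n : ℕ}
    (h : (next s (some Letter.b)).Allows s') (h' : s'.Accepted u n) :
    s.Accepted (Letter.b :: u) n := by
  cases s <;> simp only [next, Outcome.Allows, Set.mem_singleton_iff, Set.mem_empty_iff_false,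
    Set.mem_insert_iff] at h
  · rcases h with rfl | rfl
    · obtain ⟨i, j, hj, rfl, rfl⟩ := h'
      exact ⟨i + 1, j, by omega, hj, (separated_succ i j).symm, Or.inl rfl⟩
    · obtain ⟨i, j, hj, rfl, rfl⟩ := h'
      exact ⟨i + 1, n, by omega, hj, (separated_succ i n).symm, Or.inr rfl⟩
  · subst h
    obtain ⟨i, j, hj, rfl, rfl⟩ := h'
    exact ⟨i + 1, j, hj, (separated_succ i j).symm, rfl⟩
  all_goals subst h
  · obtain ⟨j, rfl, rfl⟩ := h'
    exact ⟨j, rfl, rfl⟩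
  · obtain ⟨j, rfl, rfl⟩ := h'
    exact ⟨j + 1, rfl, rfl⟩
  · obtain ⟨i, j, hj, rfl, rfl⟩ := h'
    exact ⟨i + 1, n, hj, (separated_succ i n).symm, rfl⟩
  · obtain ⟨j, rfl, rfl⟩ := h'
    exact ⟨j, rfl, rfl⟩
  · obtain ⟨j, rfl, rfl⟩ := h'
    exact ⟨j + 1, rfl, rfl⟩

lemma accepted_of_read_hash {s s' : WitnessState} {u : List Letter} {n : ℕ}
    (h : (next s (some Letter.hash)).Allows s') (h' : s'.Accepted u n) :
    s.Accepted (Letter.hash :: u) n := by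
  cases s <;> simp only [next, Outcome.Allows, Set.mem_singleton_iff, Set.mem_empty_iff_false] at h
  all_goals subst h
  · obtain ⟨j, rfl, rfl⟩ := h'
    exact ⟨0, j + 1, by omega, rfl, rfl⟩
  · obtain ⟨j, rfl, rfl⟩ := h'
    exact ⟨0, j + 1, by omega, rfl, rfl⟩

lemma translucent_subset {s s' : WitnessState} {c : Letter} (hc : c ≠ Letter.a)
    (h : (next s (some c)).Allows s') : translucent s = {Letter.a} := by
  cases s <;> cases c <;> simp_all [next, Outcome.Allows, translucent]

/-- An `a` may be deleted anywhere, which only changes the count. Any other letter is read with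
exactly the `a`s translucent, so it is the first letter of `withoutA`. -/
lemma accepted_read {s s' : WitnessState} {c : Letter} {x y : List Letter}
    (hx : ∀ d ∈ x, d ∈ translucent s) (h : (next s (some c)).Allows s')
    (h' : s'.Accepted (withoutA (x ++ y)) ((x ++ y).count Letter.a)) :
    s.Accepted (withoutA (x ++ c :: y)) ((x ++ c :: y).count Letter.a) := by
  by_cases hc : c = Letter.a
  · subst hc
    have := accepted_of_read_a h h'
    simpa [withoutA_append, withoutA_cons_a, add_assoc] using this
  · rw [translucent_subset hc h] at hx
    have hx' : withoutA x = [] := withoutA_eq_nil.2 hx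
    rw [withoutA_append, hx', withoutA_cons hc]
    rw [withoutA_append, hx'] at h'
    have hcount : (x ++ c :: y).count Letter.a = (x ++ y).count Letter.a := by
      simp [hc]
    rw [hcount]
    cases c with
    | a => exact absurd rfl hc
    | b => exact accepted_of_read_b h h'
    | hash => exact accepted_of_read_hash h h'

end WitnessState

lemma witnessAutomaton_sound {c : IDPDA.Config Letter WitnessState Empty}
    (h : Relation.ReflTransGen witnessAutomaton.Step c IDPDA.Config.accept) :
    ∀ s w γ, c = IDPDA.Config.run s w γ → s.Accepted (withoutA w) (w.count Letter.a) := by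
  induction h using Relation.ReflTransGen.head_induction_on with
  | refl => intro s w γ h; cases h
  | @head c d h _ ih =>
    rintro s w γ rfl
    cases h with
    | read hx ha h =>
      cases h with
      | push ha' h => cases ha'
      | pop ha' h => cases ha'
      | keep ha' h => exact accepted_read hx h (ih _ _ _ rfl)
    | @readAccept _ x y c _ hx ha h =>
      exfalso
      have h : next s (some c) = Outcome.accept := h
      cases s <;> cases c <;> simp [next] at h
    | @endmarker _ s' _ _ hx h =>
      have h : (next s none).Allows s' := h
      have ih := ih _ _ _ rfl
      cases s <;> simp only [next, Outcome.Allows, Set.mem_singleton_iff,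
        Set.mem_empty_iff_false] at h
      all_goals
        subst h
        -- Acceptance from `final` is the case of zero remaining letters.
        exact ⟨0, ih⟩
    | endAccept hx h =>
      have h : next s none = Outcome.accept := h
      cases s <;> simp [next] at h
      have : w = [] := List.eq_nil_iff_forall_not_mem.2 hx
      subst this
      exact ⟨rfl, rfl⟩

/-- Acceptance from a state. -/
def WitnessState.Reaches (s : WitnessState) (w : List Letter) : Prop :=
  Relation.ReflTransGen witnessAutomaton.Step (IDPDA.Config.run s w []) IDPDA.Config.accept

namespace WitnessState

/-- Acceptance will depend only on `withoutA` and the number of `a`s, so the hypothesis ranges over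
all such words and the place of the deleted `a` is irrelevant. -/
lemma reaches_of_read_a {s s' : WitnessState} {w : List Letter} {n : ℕ}
    (hs : (next s (some Letter.a)).Allows s') (hn : w.count Letter.a = n + 1)
    (h : ∀ w', withoutA w' = withoutA w → w'.count Letter.a = n → s'.Reaches w') :
    s.Reaches w := by
  have hmem : Letter.a ∈ w := List.count_pos_iff.1 (by omega)
  obtain ⟨x, y, rfl, hx⟩ := List.eq_append_cons_of_mem hmem
  have hτ : translucent s = {Letter.b, Letter.hash} := by
    cases s <;> simp_all [next, Outcome.Allows, translucent]
  refine Relation.ReflTransGen.head (IDPDA.Step.read (M := witnessAutomaton) (fun c hc => ?_) ?_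
    (IDPDA.Move.keep rfl hs)) (h (x ++ y) ?_ ?_)
  · show c ∈ translucent s
    rw [hτ]
    cases c with
    | a => exact absurd hc hx
    | b => simp
    | hash => simp
  · show Letter.a ∉ translucent s
    simp [hτ]
  · simp [withoutA_append, withoutA_cons_a]
  · simp only [List.count_append, List.count_cons_self] at hn ⊢
    omega

lemma reaches_of_read {s s' : WitnessState} {w u : List Letter} {c : Letter} {n : ℕ}
    (hc : c ≠ Letter.a) (hs : (next s (some c)).Allows s') (hu : withoutA w = c :: u)
    (hn : w.count Letter.a = n)
    (h : ∀ w', withoutA w' = u → w'.count Letter.a = n → s'.Reaches w') : s.Reaches w := by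
  obtain ⟨x, y, rfl, hx, -, hy⟩ := List.filter_eq_cons_iff.1 hu
  have hx : ∀ d ∈ x, d = Letter.a := by simpa using hx
  have hτ := translucent_subset hc hs
  refine Relation.ReflTransGen.head (IDPDA.Step.read (M := witnessAutomaton) (fun d hd => ?_) ?_
    (IDPDA.Move.keep rfl hs)) (h (x ++ y) ?_ ?_)
  · show d ∈ translucent s
    rw [hτ]
    exact hx d hd
  · show c ∉ translucent s
    rw [hτ]
    exact hc
  · rw [withoutA_append, withoutA_eq_nil.2 hx]
    exact hy
  · simpa [hc] using hn

lemma reaches_final {w : List Letter} (hu : withoutA w = []) (hn : w.count Letter.a = 0) :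
    final.Reaches w := by
  have : w = [] := List.eq_nil_iff_forall_not_mem.2 fun c hc =>
    List.count_eq_zero.1 hn (withoutA_eq_nil.1 hu c hc ▸ hc)
  subst this
  exact Relation.ReflTransGen.single (IDPDA.Step.endAccept (by simp) rfl)

lemma reaches_of_end {s : WitnessState} {w : List Letter} (hs : (next s none).Allows final)
    (hu : withoutA w = []) (hn : w.count Letter.a = 0) : s.Reaches w := by
  refine Relation.ReflTransGen.head (IDPDA.Step.endmarker (M := witnessAutomaton) ?_ hs)
    (reaches_final hu hn)
  intro c hc
  exact absurd (withoutA_eq_nil.1 hu c hc ▸ hc) (List.count_eq_zero.1 hn)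

lemma reaches_rest {j : ℕ} {w : List Letter} (hu : withoutA w = List.replicate j Letter.b)
    (hn : w.count Letter.a = 0) : rest.Reaches w := by
  induction j generalizing w with
  | zero => exact reaches_of_end (by simp [next, Outcome.Allows]) hu hn
  | succ j ih =>
    exact reaches_of_read (s' := rest) (by decide) (by simp [next, Outcome.Allows]) hu hn
      fun w' h1 h2 => ih h1 h2

lemma reaches_firstB {i j : ℕ} {w : List Letter} (hu : withoutA w = separated i (j + 1))
    (hn : w.count Letter.a = i) : firstB.Reaches w := by
  induction i generalizing w with
  | zero =>
    exact reaches_of_read (s' := tail) (by decide) (by simp [next, Outcome.Allows]) hu hn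
      fun w₁ h1 h2 => reaches_of_read (s' := rest) (by decide) (by simp [next, Outcome.Allows])
        h1 h2 fun w₂ h3 h4 => reaches_rest h3 h4
  | succ i ih =>
    rw [separated_succ] at hu
    exact reaches_of_read (s' := firstA) (by decide) (by simp [next, Outcome.Allows]) hu hn
      fun w₁ h1 h2 => reaches_of_read_a (s' := firstB) (by simp [next, Outcome.Allows]) h2
        fun w₂ h3 h4 => ih (h3.trans h1) h4

lemma reaches_secondB {j : ℕ} {w : List Letter} (hu : withoutA w = List.replicate j Letter.b)
    (hn : w.count Letter.a = j) : secondB.Reaches w := by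
  induction j generalizing w with
  | zero => exact reaches_of_end (by simp [next, Outcome.Allows]) hu hn
  | succ j ih =>
    exact reaches_of_read (s' := secondA) (by decide) (by simp [next, Outcome.Allows]) hu hn
      fun w₁ h1 h2 => reaches_of_read_a (s' := secondB) (by simp [next, Outcome.Allows]) h2
        fun w₂ h3 h4 => ih (h3.trans h1) h4

lemma reaches_skip {i j : ℕ} {w : List Letter} (hu : withoutA w = separated i (j + 1))
    (hn : w.count Letter.a = j + 1) : skip.Reaches w := by
  induction i generalizing w with
  | zero =>
    exact reaches_of_read (s' := secondStart) (by decide) (by simp [next, Outcome.Allows]) hu hn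
      fun w₁ h1 h2 => reaches_of_read (s' := secondA) (by decide)
        (by simp [next, Outcome.Allows]) h1 h2 fun w₂ h3 h4 =>
          reaches_of_read_a (s' := secondB) (by simp [next, Outcome.Allows]) h4
            fun w₃ h5 h6 => reaches_secondB (h5.trans h3) h6
  | succ i ih =>
    rw [separated_succ] at hu
    exact reaches_of_read (s' := skip) (by decide) (by simp [next, Outcome.Allows]) hu hn
      fun w₁ h1 h2 => ih h1 h2

end WitnessState

theorem witnessAutomaton_lang : witnessAutomaton.lang = witness := by
  ext w
  rw [mem_witness]
  constructor
  · exact fun h => witnessAutomaton_sound h start w [] rfl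
  · rintro ⟨i, j, hi, hj, hu, hn⟩
    obtain ⟨i, rfl⟩ := Nat.exists_eq_add_of_le' hi
    obtain ⟨j, rfl⟩ := Nat.exists_eq_add_of_le' hj
    have : start.Reaches w := by
      rw [separated_succ] at hu
      rcases hn with hn | hn
      · exact reaches_of_read (s' := firstA) (by decide) (by simp [next, Outcome.Allows]) hu hn
          fun w₁ h1 h2 => reaches_of_read_a (s' := firstB) (by simp [next, Outcome.Allows]) h2
            fun w₂ h3 h4 => reaches_firstB (h3.trans h1) h4
      · exact reaches_of_read (s' := skip) (by decide) (by simp [next, Outcome.Allows]) hu hn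
          fun w₁ h1 h2 => reaches_skip h1 h2
    exact this

theorem witness_mem_NIDPDAwtl : witness ∈ NIDPDAwtl Letter :=
  ⟨WitnessState, Empty, inferInstance, inferInstance, witnessAutomaton, witnessAutomaton_lang⟩

end Acceptor

/-! ### The proper inclusions -/

theorem theorem1 :
    ProperlyIncluded DIDPDAwtl NIDPDAwtl ∧
    ProperlyIncluded nrDIDPDAwtl nrNIDPDAwtl ∧
    (witness ∈ NIDPDAwtl Letter ∧ witness ∉ DIDPDAwtl Letter) ∧
    (witness ∈ nrNIDPDAwtl Letter ∧ witness ∉ nrDIDPDAwtl Letter) := by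
  have h1 := witness_mem_NIDPDAwtl
  have h2 : witness ∉ DIDPDAwtl Letter := fun h =>
    witness_notMem_nrDIDPDAwtl (DIDPDAwtl_subset_nrDIDPDAwtl _ h)
  have h3 := NIDPDAwtl_subset_nrNIDPDAwtl _ h1
  have h4 := witness_notMem_nrDIDPDAwtl
  refine ⟨⟨?_, Letter, inferInstance, witness, h1, h2⟩, ⟨?_, Letter, inferInstance, witness, h3, h4⟩,
    ⟨h1, h2⟩, h3, h4⟩
  · rintro A _ L ⟨Q, Γ, hQ, hΓ, M, -, hL⟩
    exact ⟨Q, Γ, hQ, hΓ, M, hL⟩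
  · rintro A _ L ⟨Q, Γ, hQ, hΓ, M, -, hL⟩
    exact ⟨Q, Γ, hQ, hΓ, M, hL⟩
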